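/- Let $n\ge 1$ and let $1<p<q$ be real numbers. A convex body in $\mathbb{R}^n$ is a compact convex set with non-empty interior; it is centered if $\mathbb{E}[X]=0$, where $X$ is uniformly distributed on it. A cone is a set of the form $K=\mathrm{conv}(B\cup\{v\})$, where $B$ is a subset of an affine hyperplane $H\subset\mathbb{R}^n$ and $v\notin H$; such a set $B$ is called a base of $K$. For a centered convex body $K\subset\mathbb{R}^n$ and $X\sim\mathrm{Uni}(K)$ put $$\alpha^*(K):=\max_{\theta\in S^{n-1}}\frac{\bigl|\mathbb{E}\bigl[|X\cdot\theta|^{q}\,\mathrm{sgn}(X\cdot\theta)\bigr]\bigr|^{1/q}}{\|X\cdot\theta\|_{p}},\qquad \|X\cdot\theta\|_p=\bigl(\mathbb{E}|X\cdot\theta|^p\bigr)^{1/p},$$ where $S^{n-1}$ is the Euclidean unit sphere. Let $\Delta_n\subset\mathbb{R}^n$ be any centered $n$-dimensional simplex. Then for every centered convex body $K\subset\mathbb{R}^n$ the maximum defining $\alpha^*(K)$ is attained, and $$\alpha^*(K)\le\alpha^*(\Delta_n),$$ with equality if and only if $K$ is a cone. Moreover, if $K$ is a cone, then every $\theta\in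 S^{n-1}$ at which the maximum defining $\alpha^*(K)$ is attained is normal to a base of $K$. -/

import Mathlib

open MeasureTheory

noncomputable section

/-- The uniform probability measure on a set `K ⊆ ℝⁿ`, i.e. the law of `X ∼ Uni(K)`. -/
def unif {n : ℕ} (K : Set (EuclideanSpace ℝ (Fin n))) : Measure (EuclideanSpace ℝ (Fin n)) :=
  ProbabilityTheory.cond volume K

/-- `K` is centered: `E[X] = 0` for `X ∼ Uni(K)`. -/
def IsCentered {n : ℕ} (K : Set (EuclideanSpace ℝ (Fin n))) : Prop :=
  ∫ x, x ∂(unif K) = 0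

/-- A convex body: a convex compact set with non-empty interior. -/
structure IsConvexBody {n : ℕ} (K : Set (EuclideanSpace ℝ (Fin n))) : Prop where
  convex : Convex ℝ K
  isCompact : IsCompact K
  interior_nonempty : (interior K).Nonempty

/-- An `n`-dimensional simplex in `ℝⁿ`: the convex hull of `n + 1` affinely independent points. -/
def IsSimplex {n : ℕ} (D : Set (EuclideanSpace ℝ (Fin n))) : Prop :=
  ∃ S : Affine.Simplex ℝ (EuclideanSpace ℝ (Fin n)) n, D = convexHull ℝ (Set.range S.points)

/-- `E[|X·θ|^q sgn(X·θ)]` for `X ∼ Uni(K)`. -/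
def signedMoment {n : ℕ} (q : ℝ) (K : Set (EuclideanSpace ℝ (Fin n)))
    (θ : EuclideanSpace ℝ (Fin n)) : ℝ :=
  ∫ x, |inner ℝ x θ| ^ q * Real.sign (inner ℝ x θ) ∂(unif K)

/-- `‖X·θ‖_p = (E[|X·θ|^p])^(1/p)` for `X ∼ Uni(K)`. -/
def marginalNorm {n : ℕ} (p : ℝ) (K : Set (EuclideanSpace ℝ (Fin n)))
    (θ : EuclideanSpace ℝ (Fin n)) : ℝ :=
  (∫ x, |inner ℝ x θ| ^ p ∂(unif K)) ^ (1 / p)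

/-- `|E[|X·θ|^q sgn(X·θ)]|^(1/q) / ‖X·θ‖_p` for `X ∼ Uni(K)`. -/
def asymRatio {n : ℕ} (p q : ℝ) (K : Set (EuclideanSpace ℝ (Fin n)))
    (θ : EuclideanSpace ℝ (Fin n)) : ℝ :=
  |signedMoment q K θ| ^ (1 / q) / marginalNorm p K θ

/-- `α*(K)`, the supremum of `asymRatio` over the unit sphere. -/
def alphaStar {n : ℕ} (p q : ℝ) (K : Set (EuclideanSpace ℝ (Fin n))) : ℝ :=
  sSup (asymRatio p q K '' Metric.sphere 0 1)

/-- `K` is a cone with base `B`: `B` lies in an affine hyperplane `H`, and `K` is the convex hull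
of `B` and a point `v` outside `H`. -/
def IsConeWithBase {n : ℕ} (K B : Set (EuclideanSpace ℝ (Fin n))) : Prop :=
  ∃ (H : AffineSubspace ℝ (EuclideanSpace ℝ (Fin n))) (v : EuclideanSpace ℝ (Fin n)),
    (H : Set (EuclideanSpace ℝ (Fin n))).Nonempty ∧
    Module.finrank ℝ H.direction + 1 = n ∧
    B ⊆ (H : Set (EuclideanSpace ℝ (Fin n))) ∧ v ∉ H ∧
    K = convexHull ℝ (insert v B)

/-- `K` is a cone. -/
def IsCone {n : ℕ} (K : Set (EuclideanSpace ℝ (Fin n))) : Prop :=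
  ∃ B, IsConeWithBase K B

/-- `θ` is normal to `B`: it is orthogonal to all differences of points of `B`. -/
def IsNormalTo {n : ℕ} (θ : EuclideanSpace ℝ (Fin n)) (B : Set (EuclideanSpace ℝ (Fin n))) :
    Prop :=
  θ ∈ (vectorSpan ℝ B)ᗮ

end

/-! By the Prékopa–Leindler inequality the volumes of the caps `{x ∈ K | t ≤ x · θ}`, rescaled by
`(b - t)⁻¹`, are quasi-concave in `t`, while for a cone with apex at height `b` and base normal to
`θ` they are constant. Hence the heights at which the tail of a marginal of `K` exceeds that of a
cone form an interval. If both marginals are centered and have the same `p`-th absolute moment, the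
difference `D` of their tails is orthogonal to `1` and to `|t| ^ (p - 1) * sgn t`. Subtracting from
`|t| ^ (q - 1)` the combination of these two functions that agrees with it at the endpoints of the
interval leaves a function whose sign is opposite to that of `D`, so the cone has the larger signed
`q`-th moment, and equality forces the two marginals to coincide. The matching of `p`-th moments is
achieved by scaling `θ`, which does not change the ratio. Finally, a body with the marginal of a
cone is a cone: the homotheties centered at its highest point map `K` into its caps, and have the
same volumes as these. -/

open scoped Pointwise ENNReal Topology

section PrekopaLeindler

variable {a b : ℝ}

theorem mul_measure_add_le_of_isCompact {X : Type*} [TopologicalSpace X] [MeasurableSpace X]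
    {μ : Measure X} [μ.InnerRegular] {S : Set X} (hS : MeasurableSet S) (hS0 : S.Nonempty)
    {c d w : ℝ≥0∞} (h : ∀ E ⊆ S, IsCompact E → E.Nonempty → c * μ E + d ≤ w) :
    c * μ S + d ≤ w := by
  obtain ⟨s, hs⟩ := hS0
  have h' : ∀ E ⊆ S, IsCompact E → c * μ E + d ≤ w := fun E hE hEc =>
    le_trans (by gcongr; exact Set.subset_insert s E)
      (h (insert s E) (Set.insert_subset hs hE) (hEc.insert s) (Set.insert_nonempty _ _))
  have hd : d ≤ w := by simpa using h' ∅ (Set.empty_subset _) isCompact_empty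
  rw [hS.measure_eq_iSup_isCompact, ENNReal.mul_iSup, ENNReal.iSup_add]
  refine iSup_le fun E => ?_
  by_cases hE : E ⊆ S ∧ IsCompact E
  · simpa [hE.1, hE.2] using h' E hE.1 hE.2
  · rcases not_and_or.1 hE with hE | hE <;> simpa [hE] using hd

theorem volume_smul_add_smul_ge_of_isCompact {A B : Set ℝ} (hA : IsCompact A) (hB : IsCompact B)
    (hA0 : A.Nonempty) (hB0 : B.Nonempty) (ha : 0 < a) (hb : 0 < b) :
    ENNReal.ofReal a * volume A + ENNReal.ofReal b * volume B ≤ volume (a • A + b • B) := by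
  obtain ⟨x₀, hx₀A, hx₀⟩ := hA.exists_isGreatest hA0
  obtain ⟨y₀, hy₀B, hy₀⟩ := hB.exists_isLeast hB0
  have hvolA : volume ((b * y₀) +ᵥ a • A) = ENNReal.ofReal a * volume A := by
    rw [measure_vadd, Measure.addHaar_smul, Module.finrank_self, pow_one, abs_of_pos ha]
  have hvolB : volume ((a * x₀) +ᵥ b • B) = ENNReal.ofReal b * volume B := by
    rw [measure_vadd, Measure.addHaar_smul, Module.finrank_self, pow_one, abs_of_pos hb]
  -- The two translates lie on either side of `a * x₀ + b * y₀`.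
  have hdisj : volume (((b * y₀) +ᵥ a • A) ∩ ((a * x₀) +ᵥ b • B)) = 0 := by
    refine measure_mono_null (t := {a * x₀ + b * y₀}) ?_ (by simp)
    rintro z ⟨⟨_, ⟨x, hx, rfl⟩, rfl⟩, ⟨_, ⟨y, hy, rfl⟩, hxy⟩⟩
    simp only [vadd_eq_add, smul_eq_mul, Set.mem_singleton_iff] at hxy ⊢
    nlinarith [mul_le_mul_of_nonneg_left (hx₀ hx) ha.le,
      mul_le_mul_of_nonneg_left (hy₀ hy) hb.le]
  have hmeas : MeasurableSet ((a * x₀) +ᵥ b • B) := ((hB.smul b).vadd _).measurableSet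
  rw [← hvolA, ← hvolB, ← measure_union₀ hmeas.nullMeasurableSet hdisj]
  refine measure_mono (Set.union_subset ?_ ?_)
  · rintro _ ⟨_, hx, rfl⟩
    simpa [add_comm] using
      Set.add_mem_add hx (Set.smul_mem_smul_set (a := b) hy₀B)
  · rintro _ ⟨_, hy, rfl⟩
    exact Set.add_mem_add (Set.smul_mem_smul_set (a := a) hx₀A) hy

theorem volume_smul_add_smul_ge {A B : Set ℝ} (hA : MeasurableSet A) (hB : MeasurableSet B)
    (hA0 : A.Nonempty) (hB0 : B.Nonempty) (ha : 0 < a) (hb : 0 < b) :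
    ENNReal.ofReal a * volume A + ENNReal.ofReal b * volume B ≤ volume (a • A + b • B) := by
  refine mul_measure_add_le_of_isCompact hA hA0 fun E hEA hE hE0 => ?_
  rw [add_comm]
  refine mul_measure_add_le_of_isCompact hB hB0 fun F hFB hF hF0 => ?_
  rw [add_comm]
  exact (volume_smul_add_smul_ge_of_isCompact hE hF hE0 hF0 ha hb).trans <|
    measure_mono <| Set.add_subset_add (Set.smul_set_mono hEA) (Set.smul_set_mono hFB)

theorem volume_Ioi_inter_setOf_ofReal_lt (c : ℝ≥0∞) :
    volume.restrict (Set.Ioi (0 : ℝ)) {t | ENNReal.ofReal t < c} = c := by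
  rw [Measure.restrict_apply (measurableSet_lt ENNReal.measurable_ofReal measurable_const)]
  induction c with
  | top => simp
  | coe c =>
    have : {t | ENNReal.ofReal t < c} ∩ Set.Ioi 0 = Set.Ioo 0 (c : ℝ) := by
      ext t
      rw [Set.inter_comm]
      refine and_congr_right fun ht => ?_
      rw [Set.mem_ofPred_eq, ← ENNReal.ofReal_coe_nnreal,
        ENNReal.ofReal_lt_ofReal_iff_of_nonneg (le_of_lt ht)]
    simp [this]

theorem lintegral_eq_lintegral_measure_ofReal_lt {X : Type*} [MeasurableSpace X] (μ : Measure X)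
    [SFinite μ] {f : X → ℝ≥0∞} (hf : Measurable f) :
    ∫⁻ x, f x ∂μ = ∫⁻ t in Set.Ioi (0 : ℝ), μ {x | ENNReal.ofReal t < f x} := by
  have hS : MeasurableSet {z : X × ℝ | ENNReal.ofReal z.2 < f z.1} :=
    measurableSet_lt (by fun_prop) (by fun_prop)
  have h := (Measure.prod_apply (μ := μ) (ν := volume.restrict (Set.Ioi (0 : ℝ))) hS).symm.trans
    (Measure.prod_apply_symm hS)
  simpa only [Set.preimage_ofPred_eq, volume_Ioi_inter_setOf_ofReal_lt] using h

theorem lintegral_add_le_of_iSup_eq_one {f g h : ℝ → ℝ≥0∞} (hf : Measurable f) (hg : Measurable g)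
    (hh : Measurable h) (hf1 : ⨆ x, f x = 1) (hg1 : ⨆ x, g x = 1) (ha : 0 < a) (hb : 0 < b)
    (hab : a + b = 1) (hfgh : ∀ x y, f x ^ a * g y ^ b ≤ h (a • x + b • y)) :
    ENNReal.ofReal a * (∫⁻ x, f x) + ENNReal.ofReal b * (∫⁻ x, g x) ≤ ∫⁻ x, h x := by
  have hmeas : ∀ f : ℝ → ℝ≥0∞, Measurable fun t : ℝ => volume {x | ENNReal.ofReal t < f x} :=
    fun f => Antitone.measurable fun s t hst =>
      measure_mono fun x hx => (ENNReal.ofReal_le_ofReal hst).trans_lt hx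
  rw [lintegral_eq_lintegral_measure_ofReal_lt _ hf, lintegral_eq_lintegral_measure_ofReal_lt _ hg,
    lintegral_eq_lintegral_measure_ofReal_lt _ hh, ← lintegral_const_mul _ (hmeas f),
    ← lintegral_const_mul _ (hmeas g), ← lintegral_add_left ((hmeas f).const_mul _)]
  refine lintegral_mono fun t => ?_
  rcases lt_or_ge (ENNReal.ofReal t) 1 with ht | ht
  · have hft : {x | ENNReal.ofReal t < f x}.Nonempty := by rwa [← hf1, lt_iSup_iff] at ht
    have hgt : {x | ENNReal.ofReal t < g x}.Nonempty := by rwa [← hg1, lt_iSup_iff] at ht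
    refine (volume_smul_add_smul_ge (measurableSet_lt measurable_const hf)
      (measurableSet_lt measurable_const hg) hft hgt ha hb).trans (measure_mono ?_)
    rintro _ ⟨_, ⟨x, hx, rfl⟩, _, ⟨y, hy, rfl⟩, rfl⟩
    calc ENNReal.ofReal t = ENNReal.ofReal t ^ a * ENNReal.ofReal t ^ b := by
          rw [← ENNReal.rpow_add_of_nonneg _ _ ha.le hb.le, hab, ENNReal.rpow_one]
      _ < f x ^ a * g y ^ b :=
          ENNReal.mul_lt_mul (ENNReal.rpow_lt_rpow hx ha) (ENNReal.rpow_lt_rpow hy hb)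
      _ ≤ _ := hfgh x y
  · have hft : {x | ENNReal.ofReal t < f x} = ∅ :=
      Set.eq_empty_of_forall_notMem fun x hx => ((hf1 ▸ le_iSup f x).trans ht).not_gt hx
    have hgt : {x | ENNReal.ofReal t < g x} = ∅ :=
      Set.eq_empty_of_forall_notMem fun x hx => ((hg1 ▸ le_iSup g x).trans ht).not_gt hx
    simp [hft, hgt]

theorem rpow_mul_rpow_le_ofReal_mul_add (ha : 0 < a) (hb : 0 < b) (hab : a + b = 1)
    (x y : ℝ≥0∞) : x ^ a * y ^ b ≤ ENNReal.ofReal a * x + ENNReal.ofReal b * y := by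
  induction x with
  | top => simp [ENNReal.mul_top, ha]
  | coe x =>
    induction y with
    | top => simp [ENNReal.mul_top, hb]
    | coe y =>
      lift a to NNReal using ha.le
      lift b to NNReal using hb.le
      rw [← ENNReal.coe_rpow_of_nonneg _ ha.le, ← ENNReal.coe_rpow_of_nonneg _ hb.le]
      simp only [ENNReal.ofReal_coe_nnreal]
      exact_mod_cast NNReal.geom_mean_le_arith_mean2_weighted a b x y (by exact_mod_cast hab)

theorem lintegral_rpow_mul_le_of_iSup_ne_top {f g h : ℝ → ℝ≥0∞} (hf : Measurable f)
    (hg : Measurable g) (hh : Measurable h) (hf' : ⨆ x, f x ≠ ⊤) (hg' : ⨆ x, g x ≠ ⊤)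
    (ha : 0 < a) (hb : 0 < b) (hab : a + b = 1)
    (hfgh : ∀ x y, f x ^ a * g y ^ b ≤ h (a • x + b • y)) :
    (∫⁻ x, f x) ^ a * (∫⁻ x, g x) ^ b ≤ ∫⁻ x, h x := by
  set F := ⨆ x, f x
  set G := ⨆ x, g x
  rcases eq_or_ne F 0 with hF0 | hF0
  · simp [ENNReal.iSup_eq_zero.1 hF0, ha]
  rcases eq_or_ne G 0 with hG0 | hG0
  · simp [ENNReal.iSup_eq_zero.1 hG0, hb]
  have hnorm : ∀ {u : ℝ → ℝ≥0∞}, ⨆ x, u x ≠ 0 → ⨆ x, u x ≠ ⊤ → ⨆ x, (⨆ y, u y)⁻¹ * u x = 1 :=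
    fun h0 ht => by rw [← ENNReal.mul_iSup, ENNReal.inv_mul_cancel h0 ht]
  have hprod : ∀ u v : ℝ≥0∞, (F⁻¹ * u) ^ a * (G⁻¹ * v) ^ b = F⁻¹ ^ a * G⁻¹ ^ b * (u ^ a * v ^ b) :=
    fun u v => by
      rw [ENNReal.mul_rpow_of_nonneg _ _ ha.le, ENNReal.mul_rpow_of_nonneg _ _ hb.le,
        mul_mul_mul_comm]
  have hadd := lintegral_add_le_of_iSup_eq_one (hf.const_mul F⁻¹) (hg.const_mul G⁻¹)
    (hh.const_mul (F⁻¹ ^ a * G⁻¹ ^ b)) (hnorm hF0 hf') (hnorm hG0 hg') ha hb hab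
    fun x y => by rw [hprod]; gcongr; exact hfgh x y
  have hscaled := (rpow_mul_rpow_le_ofReal_mul_add ha hb hab _ _).trans hadd
  rw [lintegral_const_mul _ hf, lintegral_const_mul _ hg, lintegral_const_mul _ hh,
    hprod] at hscaled
  have hconst0 : F⁻¹ ^ a * G⁻¹ ^ b ≠ 0 := by simp [hf', hg', ha.not_gt, hb.not_gt]
  have hconst : F⁻¹ ^ a * G⁻¹ ^ b ≠ ⊤ := by
    refine ENNReal.mul_ne_top ?_ ?_ <;> refine ENNReal.rpow_ne_top_of_nonneg (by positivity) ?_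
    exacts [ENNReal.inv_ne_top.2 hF0, ENNReal.inv_ne_top.2 hG0]
  exact (ENNReal.mul_le_mul_iff_right hconst0 hconst).1 hscaled

theorem lintegral_eq_iSup_lintegral_min_natCast {X : Type*} [MeasurableSpace X] (μ : Measure X)
    {f : X → ℝ≥0∞} (hf : Measurable f) : ∫⁻ x, f x ∂μ = ⨆ N : ℕ, ∫⁻ x, min (f x) N ∂μ := by
  rw [← lintegral_iSup (fun N => hf.min measurable_const)
    fun M N hMN x => min_le_min_left _ (by exact_mod_cast hMN)]
  refine lintegral_congr fun x => ?_
  change _ = ⨆ N : ℕ, f x ⊓ N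
  rw [← inf_iSup_eq, ENNReal.iSup_natCast, inf_top_eq]

/-- The measure `μ` satisfies the Prékopa–Leindler inequality. Making this a property of `μ` allows
it to be transferred to products, and so from `ℝ` to `ℝⁿ`. -/
def PrekopaLeindler {E : Type*} [AddCommMonoid E] [Module ℝ E] [MeasurableSpace E]
    (μ : Measure E) : Prop :=
  ∀ ⦃a b : ℝ⦄, 0 < a → 0 < b → a + b = 1 → ∀ ⦃f g h : E → ℝ≥0∞⦄, Measurable f → Measurable g →
    Measurable h → (∀ x y, f x ^ a * g y ^ b ≤ h (a • x + b • y)) →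
    (∫⁻ x, f x ∂μ) ^ a * (∫⁻ x, g x ∂μ) ^ b ≤ ∫⁻ x, h x ∂μ

theorem prekopaLeindler_volume_real : PrekopaLeindler (volume : Measure ℝ) := by
  intro a b ha hb hab f g h hf hg hh hfgh
  have hrpow : ∀ {c : ℝ}, 0 < c → ∀ u : ℕ → ℝ≥0∞, (⨆ N, u N) ^ c = ⨆ N, u N ^ c :=
    fun hc u => (ENNReal.orderIsoRpow _ hc).map_iSup u
  have hmin : ∀ (u : ℝ → ℝ≥0∞) (N : ℕ), ⨆ x, min (u x) N ≠ ⊤ := fun u N =>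
    ((iSup_le fun x => min_le_right _ _).trans_lt (ENNReal.natCast_lt_top N)).ne
  rw [lintegral_eq_iSup_lintegral_min_natCast _ hf, lintegral_eq_iSup_lintegral_min_natCast _ hg,
    hrpow ha, hrpow hb, ENNReal.iSup_mul]
  refine iSup_le fun M => ?_
  rw [ENNReal.mul_iSup]
  refine iSup_le fun N => ?_
  refine lintegral_rpow_mul_le_of_iSup_ne_top (hf.min measurable_const) (hg.min measurable_const)
    hh (hmin f M) (hmin g N) ha hb hab fun x y => le_trans ?_ (hfgh x y)
  gcongr <;> exact min_le_left _ _

variable {E F : Type*} [AddCommGroup E] [Module ℝ E] [MeasurableSpace E]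
  [AddCommGroup F] [Module ℝ F] [MeasurableSpace F]

theorem PrekopaLeindler.prod {μ : Measure E} {ν : Measure F} [SFinite ν]
    (hμ : PrekopaLeindler μ) (hν : PrekopaLeindler ν) : PrekopaLeindler (μ.prod ν) := by
  intro a b ha hb hab f g h hf hg hh hfgh
  rw [lintegral_prod _ hf.aemeasurable, lintegral_prod _ hg.aemeasurable,
    lintegral_prod _ hh.aemeasurable]
  refine hμ ha hb hab hf.lintegral_prod_right' hg.lintegral_prod_right' hh.lintegral_prod_right'
    fun x x' => hν ha hb hab (by fun_prop) (by fun_prop) (by fun_prop) fun y y' => ?_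
  exact hfgh (x, y) (x', y')

theorem PrekopaLeindler.of_measurePreserving {μ : Measure E} {ν : Measure F}
    (hμ : PrekopaLeindler μ) (T : E →ₗ[ℝ] F) (hT : MeasurePreserving T μ ν) :
    PrekopaLeindler ν := by
  intro a b ha hb hab f g h hf hg hh hfgh
  rw [← hT.lintegral_comp hf, ← hT.lintegral_comp hg, ← hT.lintegral_comp hh]
  exact hμ ha hb hab (hf.comp hT.measurable) (hg.comp hT.measurable) (hh.comp hT.measurable)
    fun x y => by simpa using hfgh (T x) (T y)

theorem prekopaLeindler_volume_pi (n : ℕ) :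
    PrekopaLeindler (volume : Measure (Fin n → ℝ)) := by
  induction n with
  | zero =>
    intro a b _ _ _ f g h _ _ _ hfgh
    have hint : ∀ u : (Fin 0 → ℝ) → ℝ≥0∞, ∫⁻ x, u x = u 0 := fun u => by
      rw [lintegral_congr fun x => congrArg u (Subsingleton.elim x 0), lintegral_const]
      simp [volume_pi]
    simpa only [hint, smul_zero, add_zero] using hfgh 0 0
  | succ n ih =>
    refine (prekopaLeindler_volume_real.prod ih).of_measurePreserving
      (Fin.consLinearEquiv ℝ fun _ => ℝ).toLinearMap ?_
    have hcons : ⇑(Fin.consLinearEquiv ℝ fun _ => ℝ).toLinearMap =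
        (MeasurableEquiv.piFinSuccAbove (fun _ : Fin (n + 1) => ℝ) 0).symm :=
      funext fun z => (Fin.insertNth_zero' z.1 z.2).symm
    rw [hcons]
    exact (volume_preserving_piFinSuccAbove (fun _ : Fin (n + 1) => ℝ) 0).symm

theorem prekopaLeindler_volume_euclideanSpace (n : ℕ) :
    PrekopaLeindler (volume : Measure (EuclideanSpace ℝ (Fin n))) :=
  (prekopaLeindler_volume_pi n).of_measurePreserving
    (WithLp.linearEquiv 2 ℝ (Fin n → ℝ)).symm.toLinearMap (PiLp.volume_preserving_toLp (Fin n))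

theorem PrekopaLeindler.min_le_measure {μ : Measure E} (hμ : PrekopaLeindler μ) {A B W : Set E}
    (hA : MeasurableSet A) (hB : MeasurableSet B) (ha : 0 < a) (hb : 0 < b) (hab : a + b = 1)
    (hW : a • A + b • B ⊆ W) : min (μ A) (μ B) ≤ μ W := by
  have h := hμ ha hb hab (f := A.indicator 1) (g := B.indicator 1)
    (h := (toMeasurable μ W).indicator 1) (measurable_one.indicator hA)
    (measurable_one.indicator hB) (measurable_one.indicator (measurableSet_toMeasurable μ W)) ?_
  · rw [lintegral_indicator_one hA, lintegral_indicator_one hB,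
      lintegral_indicator_one (measurableSet_toMeasurable μ W), measure_toMeasurable] at h
    calc min (μ A) (μ B) = min (μ A) (μ B) ^ a * min (μ A) (μ B) ^ b := by
          rw [← ENNReal.rpow_add_of_nonneg _ _ ha.le hb.le, hab, ENNReal.rpow_one]
      _ ≤ μ A ^ a * μ B ^ b := by gcongr; exacts [min_le_left _ _, min_le_right _ _]
      _ ≤ μ W := h
  · intro x y
    by_cases hx : x ∈ A
    · by_cases hy : y ∈ B
      · have hxy : a • x + b • y ∈ toMeasurable μ W := subset_toMeasurable μ W <| hW <|
          Set.add_mem_add (Set.smul_mem_smul_set hx) (Set.smul_mem_smul_set hy)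
        simp [hx, hy, hxy]
      · simp [hy, hb]
    · simp [hx, ha]

end PrekopaLeindler

section SignedRpow

variable {r s t p q : ℝ}

/-- The signed power `|t| ^ s * sgn t`, whose mean along a direction is `signedMoment`. It vanishes
at `t = 0` for every exponent. -/
noncomputable def signedRpow (s t : ℝ) : ℝ :=
  |t| ^ s * Real.sign t

theorem signedRpow_of_nonneg (hs : 0 < s) (ht : 0 ≤ t) : signedRpow s t = t ^ s := by
  rcases ht.eq_or_lt with rfl | ht
  · simp [signedRpow, Real.zero_rpow hs.ne']
  · rw [signedRpow, abs_of_pos ht, Real.sign_of_pos ht, mul_one]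

theorem signedRpow_neg (s t : ℝ) : signedRpow s (-t) = -signedRpow s t := by
  rw [signedRpow, signedRpow, abs_neg, Real.sign_neg, mul_neg]

theorem signedRpow_mul (s x y : ℝ) : signedRpow s (x * y) = signedRpow s x * signedRpow s y := by
  have hsign : Real.sign (x * y) = Real.sign x * Real.sign y := by
    rcases lt_trichotomy x 0 with hx | rfl | hx <;> rcases lt_trichotomy y 0 with hy | rfl | hy <;>
      simp [Real.sign_of_neg, Real.sign_of_pos, mul_pos_of_neg_of_neg, mul_neg_of_neg_of_pos,
        mul_neg_of_pos_of_neg, *]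
  rw [signedRpow, signedRpow, signedRpow, abs_mul, Real.mul_rpow (abs_nonneg x) (abs_nonneg y),
    hsign, mul_mul_mul_comm]

theorem abs_signedRpow (hs : 0 < s) (t : ℝ) : |signedRpow s t| = |t| ^ s := by
  rcases le_total 0 t with ht | ht
  · rw [signedRpow_of_nonneg hs ht, abs_of_nonneg ht, abs_of_nonneg (Real.rpow_nonneg ht s)]
  · rw [← abs_neg, ← signedRpow_neg, signedRpow_of_nonneg hs (neg_nonneg.2 ht), abs_of_nonpos ht,
      abs_of_nonneg (Real.rpow_nonneg (neg_nonneg.2 ht) s)]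

theorem signedRpow_eq_abs_rpow_mul (ht : t ≠ 0) : signedRpow s t = |t| ^ (s - 1) * t := by
  have hsign : |t| * Real.sign t = t := by
    rcases lt_or_gt_of_ne ht with h | h
    · rw [abs_of_neg h, Real.sign_of_neg h, mul_neg_one, neg_neg]
    · rw [abs_of_pos h, Real.sign_of_pos h, mul_one]
  nth_rw 3 [← hsign]
  rw [signedRpow, ← mul_assoc, ← Real.rpow_add_one (abs_pos.2 ht).ne', sub_add_cancel]

theorem strictMono_signedRpow (hs : 0 < s) : StrictMono (signedRpow s) :=
  strictMono_of_odd_strictMonoOn_nonneg (signedRpow_neg s) fun x hx y hy hxy => by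
    rw [signedRpow_of_nonneg hs hx, signedRpow_of_nonneg hs hy]
    exact Real.rpow_lt_rpow hx hxy hs

theorem continuous_abs_rpow (hs : 0 < s) : Continuous fun t : ℝ => |t| ^ s :=
  continuous_abs.rpow_const fun _ => Or.inr hs.le

theorem continuous_signedRpow (hs : 0 < s) : Continuous (signedRpow s) := by
  have hparts : signedRpow s = fun t => max t 0 ^ s - max (-t) 0 ^ s := by
    funext t
    rcases le_total 0 t with ht | ht
    · simp [signedRpow_of_nonneg hs ht, ht, Real.zero_rpow hs.ne']
    · rw [← neg_neg t, signedRpow_neg, signedRpow_of_nonneg hs (neg_nonneg.2 ht)]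
      simp [ht, Real.zero_rpow hs.ne']
  rw [hparts]
  exact ((continuous_id.max continuous_const).rpow_const fun _ => Or.inr hs.le).sub
    ((continuous_neg.max continuous_const).rpow_const fun _ => Or.inr hs.le)

theorem hasDerivAt_abs_rpow_eq_signedRpow (hp : 1 < p) (t : ℝ) :
    HasDerivAt (fun t : ℝ => |t| ^ p) (p * signedRpow (p - 1) t) t := by
  convert hasDerivAt_abs_rpow t hp using 1
  rcases eq_or_ne t 0 with rfl | ht
  · simp [signedRpow]
  · rw [signedRpow_eq_abs_rpow_mul ht, mul_assoc, sub_sub, one_add_one_eq_two]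

theorem hasDerivAt_signedRpow (hq : 1 < q) (t : ℝ) :
    HasDerivAt (signedRpow q) (q * |t| ^ (q - 1)) t := by
  have hne : ∀ y : ℝ, y ≠ 0 → HasDerivAt (signedRpow q) (q * |y| ^ (q - 1)) y := by
    intro y hy
    have hsign : (fun t => |t| ^ q * Real.sign y) =ᶠ[𝓝 y] signedRpow q := by
      rcases lt_or_gt_of_ne hy with h | h
      · filter_upwards [Iio_mem_nhds h] with t ht
        rw [signedRpow, Real.sign_of_neg h, Real.sign_of_neg ht]
      · filter_upwards [Ioi_mem_nhds h] with t ht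
        rw [signedRpow, Real.sign_of_pos h, Real.sign_of_pos ht]
    have hsq : Real.sign y * Real.sign y = 1 := by
      rcases lt_or_gt_of_ne hy with h | h <;> simp [Real.sign_of_neg, Real.sign_of_pos, h]
    have hval : q * |y| ^ (q - 1) = q * signedRpow (q - 1) y * Real.sign y := by
      rw [mul_assoc, signedRpow, mul_assoc, hsq, mul_one]
    rw [hval]
    exact ((hasDerivAt_abs_rpow_eq_signedRpow hq y).mul_const
      (Real.sign y)).congr_of_eventuallyEq hsign.symm
  rcases eq_or_ne t 0 with rfl | ht
  · exact hasDerivAt_of_hasDerivAt_of_ne hne (continuous_signedRpow (by linarith)).continuousAt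
      (continuous_const.mul (continuous_abs_rpow (by linarith))).continuousAt
  · exact hne t ht

theorem strictConvexOn_abs_rpow (hr : 1 < r) : StrictConvexOn ℝ Set.univ fun t : ℝ => |t| ^ r := by
  refine StrictMono.strictConvexOn_univ_of_deriv (continuous_abs_rpow (by linarith)) ?_
  rw [funext fun t => (hasDerivAt_abs_rpow_eq_signedRpow hr t).deriv]
  exact (strictMono_signedRpow (by linarith)).const_mul (by linarith)

end SignedRpow

section Interpolation

variable {p q x y : ℝ} {S : Set ℝ}

theorem pos_of_strictConvexOn_of_notMem_Icc {g : ℝ → ℝ} (hg : StrictConvexOn ℝ Set.univ g)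
    (hxy : x < y) (hx : g x = 0) (hy : g y = 0) {t : ℝ} (ht : t ∉ Set.Icc x y) : 0 < g t := by
  rcases lt_or_ge t x with htx | hxt
  · have h := hg.lt_on_openSegment (Set.mem_univ t) (Set.mem_univ y) (htx.trans hxy).ne (z := x)
      (by rw [openSegment_eq_Ioo (htx.trans hxy)]; exact ⟨htx, hxy⟩)
    simpa [hx, hy] using h
  · have hyt : y < t := not_le.1 fun h => ht ⟨hxt, h⟩
    have h := hg.lt_on_openSegment (Set.mem_univ x) (Set.mem_univ t) (hxy.trans hyt).ne (z := y)
      (by rw [openSegment_eq_Ioo (hxy.trans hyt)]; exact ⟨hxy, hyt⟩)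
    simpa [hx, hy] using h

theorem neg_of_strictConvexOn_of_mem_Ioo {g : ℝ → ℝ} (hg : StrictConvexOn ℝ Set.univ g)
    (hx : g x = 0) (hy : g y = 0) {t : ℝ} (ht : t ∈ Set.Ioo x y) : g t < 0 := by
  have hxy := ht.1.trans ht.2
  have h := hg.lt_on_openSegment (Set.mem_univ x) (Set.mem_univ y) hxy.ne
    (by rwa [openSegment_eq_Ioo hxy])
  simpa [hx, hy] using h

theorem exists_strictConvexOn_abs_rpow_sub_affine {r : ℝ} (hr : 1 < r) (hxy : x < y) :
    ∃ B C : ℝ, StrictConvexOn ℝ Set.univ (fun t : ℝ => |t| ^ r - (B + C * t)) ∧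
      |x| ^ r - (B + C * x) = 0 ∧ |y| ^ r - (B + C * y) = 0 := by
  set C := (|y| ^ r - |x| ^ r) / (y - x)
  have hC : C * (y - x) = |y| ^ r - |x| ^ r := div_mul_cancel₀ _ (sub_pos.2 hxy).ne'
  refine ⟨|x| ^ r - C * x, C, ?_, by ring, by linarith⟩
  refine (strictConvexOn_abs_rpow hr).sub_concaveOn ⟨convex_univ, fun s _ t _ a b _ _ hab => ?_⟩
  simp only [smul_eq_mul]
  linear_combination (|x| ^ r - C * x) * hab

-- In the variable `u = signedRpow (p - 1) t` the weight is the strictly convex function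
-- `|u| ^ ((q - 1) / (p - 1))` minus its affine interpolant at two points.
theorem exists_interpolant (hp : 1 < p) (hpq : p < q) (hxy : x < y) :
    ∃ B C : ℝ, (∀ t ∈ Set.Ioo x y, |t| ^ (q - 1) - (B + C * signedRpow (p - 1) t) < 0) ∧
      ∀ t ∉ Set.Icc x y, 0 < |t| ^ (q - 1) - (B + C * signedRpow (p - 1) t) := by
  have hp' : 0 < p - 1 := by linarith
  have hu : StrictMono (signedRpow (p - 1)) := strictMono_signedRpow hp'
  have hr : 1 < (q - 1) / (p - 1) := (one_lt_div hp').2 (by linarith)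
  have hur : ∀ t, |signedRpow (p - 1) t| ^ ((q - 1) / (p - 1)) = |t| ^ (q - 1) := fun t => by
    rw [abs_signedRpow hp', ← Real.rpow_mul (abs_nonneg t), mul_div_cancel₀ _ hp'.ne']
  obtain ⟨B, C, hconv, hx, hy⟩ := exists_strictConvexOn_abs_rpow_sub_affine hr (hu hxy)
  refine ⟨B, C, fun t ht => ?_, fun t ht => ?_⟩
  · rw [← hur]
    exact neg_of_strictConvexOn_of_mem_Ioo hconv hx hy ⟨hu ht.1, hu ht.2⟩
  · rw [← hur]
    exact pos_of_strictConvexOn_of_notMem_Icc hconv (hu hxy) hx hy fun h =>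
      ht ⟨hu.le_iff_le.1 h.1, hu.le_iff_le.1 h.2⟩

theorem exists_interpolant_of_ordConnected (hp : 1 < p) (hpq : p < q) (hS : S.OrdConnected)
    (hSb : Bornology.IsBounded S) (hSn : S.Nontrivial) :
    ∃ B C : ℝ, ∀ᵐ t, (t ∈ S → |t| ^ (q - 1) - (B + C * signedRpow (p - 1) t) < 0) ∧
      (t ∉ S → 0 < |t| ^ (q - 1) - (B + C * signedRpow (p - 1) t)) := by
  have hsub : S ⊆ Set.Icc (sInf S) (sSup S) := subset_Icc_csInf_csSup hSb.bddBelow hSb.bddAbove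
  have hsup : Set.Ioo (sInf S) (sSup S) ⊆ S :=
    IsConnected.Ioo_csInf_csSup_subset ⟨hSn.nonempty, hS.isPreconnected⟩ hSb.bddBelow hSb.bddAbove
  obtain ⟨x, hx, y, hy, hxy⟩ := hSn.exists_lt
  obtain ⟨B, C, hneg, hpos⟩ := exists_interpolant hp hpq
    (((hsub hx).1.trans_lt hxy).trans_le (hsub hy).2)
  refine ⟨B, C, ?_⟩
  filter_upwards [Measure.ae_ne volume (sInf S), Measure.ae_ne volume (sSup S)] with t ht₁ ht₂
  exact ⟨fun h => hneg t ⟨(hsub h).1.lt_of_ne' ht₁, (hsub h).2.lt_of_ne ht₂⟩,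
    fun h => hpos t fun h' => h (hsup ⟨h'.1.lt_of_ne' ht₁, h'.2.lt_of_ne ht₂⟩)⟩

theorem ae_eq_zero_of_subsingleton_setOf_pos {D : ℝ → ℝ} (hD : Integrable D) (h0 : ∫ t, D t = 0)
    (hS : {t | 0 < D t}.Subsingleton) : D =ᵐ[volume] 0 := by
  have hnonpos : 0 ≤ᵐ[volume] -D := by
    filter_upwards [measure_eq_zero_iff_ae_notMem.1 (hS.measure_zero volume)] with t ht
    simpa using ht
  have h := (integral_eq_zero_iff_of_nonneg_ae hnonpos hD.neg).1 (by simp [integral_neg, h0])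
  filter_upwards [h] with t ht using by simpa using ht

theorem integral_abs_rpow_mul_nonpos (hp : 1 < p) (hpq : p < q) {D : ℝ → ℝ} (hD : Integrable D)
    (hDp : Integrable fun t => signedRpow (p - 1) t * D t)
    (hDq : Integrable fun t => |t| ^ (q - 1) * D t) (hS : {t | 0 < D t}.OrdConnected)
    (hSb : Bornology.IsBounded {t | 0 < D t}) (h0 : ∫ t, D t = 0)
    (h1 : ∫ t, signedRpow (p - 1) t * D t = 0) :
    ∫ t, |t| ^ (q - 1) * D t ≤ 0 ∧ (∫ t, |t| ^ (q - 1) * D t = 0 → D =ᵐ[volume] 0) := by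
  rcases Set.subsingleton_or_nontrivial {t | 0 < D t} with hss | hnt
  · have hD0 := ae_eq_zero_of_subsingleton_setOf_pos hD h0 hss
    refine ⟨le_of_eq (integral_eq_zero_of_ae ?_), fun _ => hD0⟩
    filter_upwards [hD0] with t ht
    simp [ht]
  obtain ⟨B, C, hw⟩ := exists_interpolant_of_ordConnected hp hpq hS hSb hnt
  have hsplit : (fun t => (|t| ^ (q - 1) - (B + C * signedRpow (p - 1) t)) * D t) =
      fun t => |t| ^ (q - 1) * D t - (B * D t + C * (signedRpow (p - 1) t * D t)) := by
    funext t
    ring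
  have hlow : Integrable fun t => B * D t + C * (signedRpow (p - 1) t * D t) :=
    (hD.const_mul B).add (hDp.const_mul C)
  have hwint : Integrable fun t => (|t| ^ (q - 1) - (B + C * signedRpow (p - 1) t)) * D t :=
    hsplit ▸ hDq.sub hlow
  have hweq : ∫ t, |t| ^ (q - 1) * D t =
      ∫ t, (|t| ^ (q - 1) - (B + C * signedRpow (p - 1) t)) * D t := by
    rw [hsplit, integral_sub hDq hlow, integral_add (hD.const_mul B) (hDp.const_mul C),
      integral_const_mul, integral_const_mul, h0, h1]
    ring
  have hnonpos : ∀ᵐ t, 0 ≤ -((|t| ^ (q - 1) - (B + C * signedRpow (p - 1) t)) * D t) := by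
    filter_upwards [hw] with t ht
    rw [neg_nonneg]
    by_cases h : 0 < D t
    · exact mul_nonpos_of_nonpos_of_nonneg (ht.1 h).le h.le
    · exact mul_nonpos_of_nonneg_of_nonpos (ht.2 h).le (not_lt.1 h)
  rw [hweq]
  refine ⟨?_, fun hz => ?_⟩
  · simpa [integral_neg] using integral_nonneg_of_ae hnonpos
  · have hzero := (integral_eq_zero_iff_of_nonneg_ae hnonpos hwint.neg).1
      (by simp [integral_neg, hz])
    filter_upwards [hw, hzero] with t ht htz
    refine (mul_eq_zero.1 (neg_eq_zero.1 htz)).resolve_left ?_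
    by_cases h : 0 < D t
    · exact (ht.1 h).ne
    · exact (ht.2 h).ne'

end Interpolation

section MomentComparison

theorem measureReal_Ici_eq_zero {μ : Measure ℝ} {M : ℝ} (hμ : ∀ᵐ x ∂μ, x ∈ Set.Icc (-M) M)
    {t : ℝ} (ht : M < t) :
    μ.real (Set.Ici t) = 0 := by
  have h : μ (Set.Ici t) = 0 :=
    measure_eq_zero_iff_ae_notMem.2 (hμ.mono fun x hx h => (hx.2.trans_lt ht).not_ge h)
  rw [Measure.real, h, ENNReal.toReal_zero]

variable {μ ν : Measure ℝ} [IsProbabilityMeasure μ] [IsProbabilityMeasure ν] {M p q : ℝ}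

theorem integral_eq_add_setIntegral_mul_measureReal_Ici (hμ : ∀ᵐ x ∂μ, x ∈ Set.Icc (-M) M)
    {ψ ψ' : ℝ → ℝ} (hψ : ∀ t, HasDerivAt ψ (ψ' t) t) (hψ' : Continuous ψ') :
    ∫ x, ψ x ∂μ = ψ (-M) + ∫ t in Set.Ioc (-M) M, ψ' t * μ.real (Set.Ici t) := by
  have hmeas : Measurable (Function.uncurry fun x t : ℝ => (Set.Iic x).indicator ψ' t) :=
    (hψ'.measurable.comp measurable_snd).indicator (measurableSet_le measurable_snd measurable_fst)
  obtain ⟨Q, hQ⟩ := isCompact_Icc.exists_bound_of_continuousOn (s := Set.Icc (-M) M)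
    hψ'.continuousOn
  have hint : Integrable (Function.uncurry fun x t : ℝ => (Set.Iic x).indicator ψ' t)
      (μ.prod (volume.restrict (Set.Ioc (-M) M))) := by
    refine Integrable.of_bound hmeas.aestronglyMeasurable Q ?_
    have hsnd : ∀ᵐ z ∂(μ.prod (volume.restrict (Set.Ioc (-M) M))), z.2 ∈ Set.Ioc (-M) M :=
      Measure.quasiMeasurePreserving_snd.ae (ae_restrict_mem measurableSet_Ioc)
    filter_upwards [hsnd] with z hz
    exact (norm_indicator_le_norm_self ψ' z.2).trans (hQ z.2 (Set.Ioc_subset_Icc_self hz))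
  have hftc : ∀ᵐ x ∂μ, ψ x = ψ (-M) + ∫ t in Set.Ioc (-M) M, (Set.Iic x).indicator ψ' t := by
    filter_upwards [hμ] with x hx
    have h := intervalIntegral.integral_eq_sub_of_hasDerivAt (fun t _ => hψ t)
      (hψ'.intervalIntegrable (-M) x)
    rw [intervalIntegral.integral_of_le hx.1] at h
    rw [setIntegral_indicator measurableSet_Iic, Set.Ioc_inter_Iic, min_eq_right hx.2, h]
    ring
  have hinner : ∀ t, ∫ x, (Set.Iic x).indicator ψ' t ∂μ = ψ' t * μ.real (Set.Ici t) := fun t => by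
    have hswap : (fun x => (Set.Iic x).indicator ψ' t) = (Set.Ici t).indicator fun _ => ψ' t := by
      funext x
      simp [Set.indicator]
    rw [hswap, integral_indicator_const _ measurableSet_Ici, smul_eq_mul, mul_comm]
  have hint' : Integrable (fun x => ∫ t in Set.Ioc (-M) M, (Set.Iic x).indicator ψ' t) μ :=
    hint.integral_prod_left
  rw [integral_congr_ae hftc, integral_add (integrable_const _) hint',
    integral_integral_swap hint]
  simp [hinner]

theorem measureReal_Ici_eq_one (hμ : ∀ᵐ x ∂μ, x ∈ Set.Icc (-M) M) {t : ℝ} (ht : t ≤ -M) :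
    μ.real (Set.Ici t) = 1 := by
  have h : ∀ᵐ x ∂μ, x ∈ Set.Ici t := hμ.mono fun x hx => ht.trans hx.1
  rw [Measure.real, (mem_ae_iff_prob_eq_one measurableSet_Ici).1 h, ENNReal.toReal_one]

theorem measureReal_Ici_sub_eq_zero (hμ : ∀ᵐ x ∂μ, x ∈ Set.Icc (-M) M)
    (hν : ∀ᵐ x ∂ν, x ∈ Set.Icc (-M) M) {t : ℝ} (ht : t ∉ Set.Ioc (-M) M) :
    μ.real (Set.Ici t) - ν.real (Set.Ici t) = 0 := by
  rcases le_or_gt t (-M) with h | h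
  · rw [measureReal_Ici_eq_one hμ h, measureReal_Ici_eq_one hν h, sub_self]
  · have hMt : M < t := not_le.1 fun h' => ht ⟨h, h'⟩
    rw [measureReal_Ici_eq_zero hμ hMt, measureReal_Ici_eq_zero hν hMt, sub_self]

theorem integrableOn_mul_measureReal_Ici (μ : Measure ℝ) [IsProbabilityMeasure μ] (M : ℝ)
    {g : ℝ → ℝ} (hg : Continuous g) :
    IntegrableOn (fun t => g t * μ.real (Set.Ici t)) (Set.Ioc (-M) M) := by
  have hanti : Antitone fun t => μ.real (Set.Ici t) := fun s t hst =>
    measureReal_mono (Set.Ici_subset_Ici.2 hst)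
  refine Integrable.mul_bdd (c := 1) ?_ hanti.measurable.aestronglyMeasurable
    (ae_of_all _ fun t => ?_)
  · exact (hg.continuousOn.integrableOn_compact isCompact_Icc).mono_set Set.Ioc_subset_Icc_self
  · rw [Real.norm_of_nonneg measureReal_nonneg]
    exact measureReal_le_one

theorem integrable_mul_measureReal_Ici_sub (hμ : ∀ᵐ x ∂μ, x ∈ Set.Icc (-M) M)
    (hν : ∀ᵐ x ∂ν, x ∈ Set.Icc (-M) M) {g : ℝ → ℝ} (hg : Continuous g) :
    Integrable fun t => g t * (μ.real (Set.Ici t) - ν.real (Set.Ici t)) := by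
  have h : IntegrableOn (fun t => g t * (μ.real (Set.Ici t) - ν.real (Set.Ici t)))
      (Set.Ioc (-M) M) := by
    simp only [mul_sub]
    exact (integrableOn_mul_measureReal_Ici μ M hg).sub (integrableOn_mul_measureReal_Ici ν M hg)
  refine (integrableOn_iff_integrable_of_support_subset fun t ht => ?_).1 h
  by_contra htM
  exact ht (by simp only [measureReal_Ici_sub_eq_zero hμ hν htM, mul_zero])

theorem integral_sub_integral_eq_integral_mul_measureReal_Ici
    (hμ : ∀ᵐ x ∂μ, x ∈ Set.Icc (-M) M) (hν : ∀ᵐ x ∂ν, x ∈ Set.Icc (-M) M)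
    {ψ ψ' : ℝ → ℝ} (hψ : ∀ t, HasDerivAt ψ (ψ' t) t) (hψ' : Continuous ψ') :
    ∫ x, ψ x ∂μ - ∫ x, ψ x ∂ν =
      ∫ t, ψ' t * (μ.real (Set.Ici t) - ν.real (Set.Ici t)) := by
  rw [integral_eq_add_setIntegral_mul_measureReal_Ici hμ hψ hψ',
    integral_eq_add_setIntegral_mul_measureReal_Ici hν hψ hψ', add_sub_add_left_eq_sub,
    ← integral_sub (integrableOn_mul_measureReal_Ici μ M hψ')
      (integrableOn_mul_measureReal_Ici ν M hψ')]
  simp only [← mul_sub]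
  exact setIntegral_eq_integral_of_forall_compl_eq_zero fun t ht => by
    rw [measureReal_Ici_sub_eq_zero hμ hν ht, mul_zero]

theorem eq_of_ae_measureReal_Ici_eq
    (h : ∀ᵐ t, μ.real (Set.Ici t) = ν.real (Set.Ici t)) : μ = ν := by
  refine Measure.ext_of_Ici μ ν fun t => ?_
  obtain ⟨u, hu, hut, hlim⟩ := (Measure.dense_of_ae h).exists_seq_strictMono_tendsto t
  have hIci : ⋂ k, Set.Ici (u k) = Set.Ici t := by
    ext x
    simp only [Set.mem_iInter, Set.mem_Ici]
    exact ⟨fun hx => le_of_tendsto' hlim hx, fun hx k => (hut k).1.le.trans hx⟩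
  have hcont : ∀ (ρ : Measure ℝ) [IsProbabilityMeasure ρ],
      Filter.Tendsto (fun k => ρ (Set.Ici (u k))) Filter.atTop (𝓝 (ρ (Set.Ici t))) := fun ρ _ =>
    hIci ▸ tendsto_measure_iInter_atTop (fun k => measurableSet_Ici.nullMeasurableSet)
      (fun _ _ hkl => Set.Ici_subset_Ici.2 (hu.monotone hkl)) ⟨0, measure_ne_top ρ _⟩
  refine tendsto_nhds_unique (hcont μ) ((hcont ν).congr fun k => ?_)
  exact ((measureReal_eq_measureReal_iff).1 (hut k).2).symm

theorem integral_signedRpow_le_of_ordConnected (hp : 1 < p) (hpq : p < q)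
    (hμ : ∀ᵐ x ∂μ, x ∈ Set.Icc (-M) M) (hν : ∀ᵐ x ∂ν, x ∈ Set.Icc (-M) M)
    (hmean : ∫ x, x ∂μ = ∫ x, x ∂ν) (hnorm : ∫ x, |x| ^ p ∂μ = ∫ x, |x| ^ p ∂ν)
    (hS : {t | ν.real (Set.Ici t) < μ.real (Set.Ici t)}.OrdConnected) :
    ∫ x, signedRpow q x ∂μ ≤ ∫ x, signedRpow q x ∂ν ∧
      (∫ x, signedRpow q x ∂μ = ∫ x, signedRpow q x ∂ν → μ = ν) := by
  set D : ℝ → ℝ := fun t => μ.real (Set.Ici t) - ν.real (Set.Ici t) with hD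
  have hcp : Continuous (signedRpow (p - 1)) := continuous_signedRpow (by linarith)
  have hcq : Continuous fun t : ℝ => |t| ^ (q - 1) := continuous_abs_rpow (by linarith)
  have hpos : {t | 0 < D t} = {t | ν.real (Set.Ici t) < μ.real (Set.Ici t)} := by
    simp only [hD, sub_pos]
  have hbdd : Bornology.IsBounded {t | 0 < D t} :=
    (Metric.isBounded_Ioc (-M) M).subset fun t ht => by
      by_contra htM
      have htD : 0 < D t := ht
      exact htD.ne' (measureReal_Ici_sub_eq_zero hμ hν htM)
  have h0 : ∫ t, D t = 0 := by
    simpa [hmean] using (integral_sub_integral_eq_integral_mul_measureReal_Ici hμ hν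
      hasDerivAt_id continuous_const).symm
  have h1 : ∫ t, signedRpow (p - 1) t * D t = 0 := by
    have h := integral_sub_integral_eq_integral_mul_measureReal_Ici hμ hν
      (hasDerivAt_abs_rpow_eq_signedRpow hp) (hcp.const_mul p)
    simp only [hnorm, sub_self, mul_assoc, integral_const_mul] at h
    exact (mul_eq_zero.1 h.symm).resolve_left (by linarith)
  have hq : ∫ x, signedRpow q x ∂μ - ∫ x, signedRpow q x ∂ν = q * ∫ t, |t| ^ (q - 1) * D t := by
    rw [integral_sub_integral_eq_integral_mul_measureReal_Ici hμ hν
      (hasDerivAt_signedRpow (hp.trans hpq)) (hcq.const_mul q), ← integral_const_mul]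
    simp only [mul_assoc, hD]
  obtain ⟨hle, heq⟩ := integral_abs_rpow_mul_nonpos hp hpq
    (by simpa using integrable_mul_measureReal_Ici_sub hμ hν continuous_one)
    (integrable_mul_measureReal_Ici_sub hμ hν hcp) (integrable_mul_measureReal_Ici_sub hμ hν hcq)
    (hpos ▸ hS) hbdd h0 h1
  have hq0 : 0 < q := by linarith
  refine ⟨sub_nonpos.1 (hq ▸ mul_nonpos_of_nonneg_of_nonpos hq0.le hle), fun h => ?_⟩
  have hz := heq ((mul_eq_zero.1 (hq.symm.trans (sub_eq_zero.2 h))).resolve_left hq0.ne')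
  exact eq_of_ae_measureReal_Ici_eq (hz.mono fun t ht => sub_eq_zero.1 ht)

end MomentComparison

section Marginal

variable {n : ℕ} {K : Set (EuclideanSpace ℝ (Fin n))} {θ : EuclideanSpace ℝ (Fin n)}

/-- The law of `X · θ` for `X ∼ Uni(K)`, through which all moments of the problem are computed. -/
noncomputable def marginal (K : Set (EuclideanSpace ℝ (Fin n))) (θ : EuclideanSpace ℝ (Fin n)) :
    Measure ℝ :=
  (unif K).map fun x => inner ℝ x θ

/-- The part of `K` at height at least `t` in the direction `θ`. Its share of the volume of `K` is
the tail of `marginal K θ` at `t`. -/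
def cap (K : Set (EuclideanSpace ℝ (Fin n))) (θ : EuclideanSpace ℝ (Fin n)) (t : ℝ) :
    Set (EuclideanSpace ℝ (Fin n)) :=
  K ∩ {x | t ≤ inner ℝ x θ}

theorem isClosed_setOf_le_inner (θ : EuclideanSpace ℝ (Fin n)) (t : ℝ) :
    IsClosed {x : EuclideanSpace ℝ (Fin n) | t ≤ inner ℝ x θ} :=
  isClosed_le continuous_const (by fun_prop)

theorem isCompact_cap (hK : IsCompact K) (θ : EuclideanSpace ℝ (Fin n)) (t : ℝ) :
    IsCompact (cap K θ t) :=
  hK.inter_right (isClosed_setOf_le_inner θ t)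

theorem measureReal_marginal_Ici (hK : MeasurableSet K) (θ : EuclideanSpace ℝ (Fin n)) (t : ℝ) :
    (marginal K θ).real (Set.Ici t) = volume.real (cap K θ t) / volume.real K := by
  rw [Measure.real, marginal, Measure.map_apply (by fun_prop) measurableSet_Ici, unif,
    ProbabilityTheory.cond_apply hK, ENNReal.toReal_mul, ENNReal.toReal_inv, inv_mul_eq_div]
  rfl

theorem integral_marginal {f : ℝ → ℝ} (hf : Continuous f) :
    ∫ t, f t ∂marginal K θ = ∫ x, f (inner ℝ x θ) ∂unif K :=
  integral_map (by fun_prop) hf.aestronglyMeasurable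

theorem eventually_ae_marginal_mem_Icc (hK : IsCompact K) (θ : EuclideanSpace ℝ (Fin n)) :
    ∀ᶠ M in Filter.atTop, ∀ᵐ t ∂marginal K θ, t ∈ Set.Icc (-M) M := by
  obtain ⟨C, hC⟩ := hK.exists_bound_of_continuousOn (f := fun x => inner ℝ x θ) (by fun_prop)
  filter_upwards [Filter.eventually_ge_atTop C] with M hM
  refine (ae_map_iff (p := fun t => t ∈ Set.Icc (-M) M) (by fun_prop) measurableSet_Icc).2 ?_
  filter_upwards [ProbabilityTheory.ae_cond_mem hK.measurableSet] with x hx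
  exact abs_le.1 ((hC x hx).trans hM)

namespace IsConvexBody

theorem volume_ne_zero (hK : IsConvexBody K) : volume K ≠ 0 :=
  (Measure.measure_pos_of_nonempty_interior _ hK.interior_nonempty).ne'

theorem volume_ne_top (hK : IsConvexBody K) : volume K ≠ ∞ :=
  hK.isCompact.measure_lt_top.ne

theorem volume_real_pos (hK : IsConvexBody K) : 0 < volume.real K :=
  ENNReal.toReal_pos hK.volume_ne_zero hK.volume_ne_top

theorem isProbabilityMeasure_unif (hK : IsConvexBody K) : IsProbabilityMeasure (unif K) :=
  ProbabilityTheory.cond_isProbabilityMeasure_of_finite hK.volume_ne_zero hK.volume_ne_top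

theorem isProbabilityMeasure_marginal (hK : IsConvexBody K) (θ : EuclideanSpace ℝ (Fin n)) :
    IsProbabilityMeasure (marginal K θ) :=
  have := hK.isProbabilityMeasure_unif
  Measure.isProbabilityMeasure_map (by fun_prop)

theorem integrable_unif (hK : IsConvexBody K) {f : EuclideanSpace ℝ (Fin n) → ℝ}
    (hf : Continuous f) : Integrable f (unif K) :=
  (hf.continuousOn.integrableOn_compact hK.isCompact).smul_measure
    (ENNReal.inv_ne_top.2 hK.volume_ne_zero)

theorem integral_id_marginal (hK : IsConvexBody K) (hK0 : IsCentered K)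
    (θ : EuclideanSpace ℝ (Fin n)) : ∫ t, t ∂marginal K θ = 0 := by
  have hint : Integrable (fun x => x) (unif K) :=
    (continuous_id.continuousOn.integrableOn_compact hK.isCompact).smul_measure
      (ENNReal.inv_ne_top.2 hK.volume_ne_zero)
  have hmean : ∫ x, x ∂unif K = 0 := hK0
  simp_rw [integral_marginal continuous_id', real_inner_comm θ]
  rw [integral_inner hint θ, hmean, inner_zero_right]

theorem volume_inter_pos (hK : IsConvexBody K) {U : Set (EuclideanSpace ℝ (Fin n))}
    (hU : IsOpen U) (h : (K ∩ U).Nonempty) : 0 < volume (K ∩ U) := by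
  have hcl : closure (interior K) = K := by
    rw [hK.convex.closure_interior_eq_closure_of_nonempty_interior hK.interior_nonempty,
      hK.isCompact.isClosed.closure_eq]
  obtain ⟨x, hxK, hxU⟩ := h
  obtain ⟨y, hyU, hyK⟩ := mem_closure_iff.1 (hcl.symm ▸ hxK) U hU hxU
  exact ((isOpen_interior.inter hU).measure_pos _ ⟨y, hyK, hyU⟩).trans_le
    (measure_mono (Set.inter_subset_inter_left _ interior_subset))

theorem subset_of_volume_le (hK : IsConvexBody K) {L : Set (EuclideanSpace ℝ (Fin n))}
    (hL : IsClosed L) (hLK : L ⊆ K) (h : volume K ≤ volume L) : K ⊆ L := by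
  by_contra hKL
  have hpos := hK.volume_inter_pos hL.isOpen_compl (Set.inter_compl_nonempty_iff.2 hKL)
  rw [← Set.sdiff_eq, measure_sdiff hLK hL.nullMeasurableSet
    (measure_ne_top_of_subset hLK hK.volume_ne_top), tsub_pos_iff_lt] at hpos
  exact hpos.not_ge h

end IsConvexBody

end Marginal

section TailComparison

variable {n : ℕ} {a b s t u : ℝ} {K : Set (EuclideanSpace ℝ (Fin n))}
  {θ : EuclideanSpace ℝ (Fin n)}

/-- The tail of the marginal of an `n`-dimensional cone in the direction normal to its base, when
the base is at height `a` and the apex at height `b > a`. -/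
noncomputable def coneTail (n : ℕ) (a b t : ℝ) : ℝ :=
  (max 0 (min 1 ((b - t) / (b - a)))) ^ n

theorem coneTail_of_le (hab : a < b) (ht : t ≤ a) : coneTail n a b t = 1 := by
  have h : 1 ≤ (b - t) / (b - a) := (one_le_div (sub_pos.2 hab)).2 (by linarith)
  simp [coneTail, h]

theorem coneTail_of_ge (hab : a < b) (ht : b ≤ t) : coneTail n a b t = 0 ^ n := by
  have h : (b - t) / (b - a) ≤ 0 :=
    div_nonpos_of_nonpos_of_nonneg (sub_nonpos.2 ht) (sub_pos.2 hab).le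
  rw [coneTail, max_eq_left ((min_le_right _ _).trans h)]

theorem coneTail_of_mem_Icc (hab : a < b) (ht : t ∈ Set.Icc a b) :
    coneTail n a b t = ((b - t) / (b - a)) ^ n := by
  have h1 : (b - t) / (b - a) ≤ 1 := (div_le_one (sub_pos.2 hab)).2 (by linarith [ht.1])
  have h0 : 0 ≤ (b - t) / (b - a) := div_nonneg (sub_nonneg.2 ht.2) (sub_pos.2 hab).le
  rw [coneTail, min_eq_right h1, max_eq_right h0]

theorem continuous_coneTail (n : ℕ) (a b : ℝ) : Continuous (coneTail n a b) := by
  unfold coneTail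
  fun_prop

-- Rescaling by `(b - t)⁻¹` makes all caps of a cone with apex at height `b` congruent.
theorem min_volume_smul_cap_le (hK : Convex ℝ K) (hKm : MeasurableSet K) (hst : s < t)
    (htu : t < u) (hub : u < b) :
    min (volume ((b - s)⁻¹ • cap K θ s)) (volume ((b - u)⁻¹ • cap K θ u)) ≤
      volume ((b - t)⁻¹ • cap K θ t) := by
  have hs : 0 < b - s := by linarith
  have ht : 0 < b - t := by linarith
  have hu : 0 < b - u := by linarith
  have hut : 0 < u - t := by linarith
  have hts : 0 < t - s := by linarith
  have hus : 0 < u - s := by linarith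
  have hmeas : ∀ r, MeasurableSet (cap K θ r) := fun r =>
    hKm.inter (isClosed_setOf_le_inner θ r).measurableSet
  refine (prekopaLeindler_volume_euclideanSpace n).min_le_measure
    ((hmeas s).const_smul₀ _) ((hmeas u).const_smul₀ _)
    (a := (u - t) * (b - s) / ((u - s) * (b - t))) (b := (t - s) * (b - u) / ((u - s) * (b - t)))
    (by positivity) (by positivity) (by field_simp; ring) ?_
  rintro _ ⟨_, ⟨_, ⟨x, hx, rfl⟩, rfl⟩, _, ⟨_, ⟨y, hy, rfl⟩, rfl⟩, rfl⟩
  have hx0 : 0 ≤ (u - t) / (u - s) := by positivity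
  have hy0 : 0 ≤ (t - s) / (u - s) := by positivity
  have hsum : (u - t) / (u - s) + (t - s) / (u - s) = 1 := by field_simp; ring
  refine ⟨((u - t) / (u - s)) • x + ((t - s) / (u - s)) • y,
    ⟨hK hx.1 hy.1 hx0 hy0 hsum, ?_⟩, ?_⟩
  · have hxs : s ≤ inner ℝ x θ := hx.2
    have hyu : u ≤ inner ℝ y θ := hy.2
    rw [Set.mem_ofPred_eq, inner_add_left, real_inner_smul_left, real_inner_smul_left]
    calc t = (u - t) / (u - s) * s + (t - s) / (u - s) * u := by field_simp; ring
      _ ≤ _ := add_le_add (mul_le_mul_of_nonneg_left hxs hx0) (mul_le_mul_of_nonneg_left hyu hy0)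
  · simp only [smul_add, smul_smul]
    congr 2 <;> field_simp

theorem IsConvexBody.coneTail_lt_measureReal_marginal_Ici_iff (hK : IsConvexBody K)
    (hat : a ≤ t) (htb : t < b) :
    coneTail n a b t < (marginal K θ).real (Set.Ici t) ↔
      ENNReal.ofReal (volume.real K / (b - a) ^ n) < volume ((b - t)⁻¹ • cap K θ t) := by
  have hV := hK.volume_real_pos
  have ht : 0 < b - t := sub_pos.2 htb
  have ha : 0 < b - a := by linarith
  have hvol : (volume ((b - t)⁻¹ • cap K θ t)).toReal = volume.real (cap K θ t) / (b - t) ^ n := by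
    rw [Measure.addHaar_smul_of_nonneg _ (inv_nonneg.2 ht.le), ENNReal.toReal_mul,
      finrank_euclideanSpace_fin, ENNReal.toReal_ofReal (by positivity), inv_pow, inv_mul_eq_div]
    rfl
  rw [coneTail_of_mem_Icc (by linarith) ⟨hat, htb.le⟩,
    measureReal_marginal_Ici hK.isCompact.measurableSet, div_pow,
    ENNReal.ofReal_lt_iff_lt_toReal (by positivity)
      ((isCompact_cap hK.isCompact θ t).smul _).measure_lt_top.ne, hvol,
    div_lt_div_iff₀ (by positivity) (by positivity),
    div_lt_div_iff₀ (by positivity) (by positivity), mul_comm (volume.real K)]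

theorem IsConvexBody.coneTail_lt_measureReal_marginal_Ici_of_lt (hK : IsConvexBody K)
    (has : a ≤ s) (hst : s < t) (htu : t < u) (hub : u < b)
    (hs : coneTail n a b s < (marginal K θ).real (Set.Ici s))
    (hu : coneTail n a b u < (marginal K θ).real (Set.Ici u)) :
    coneTail n a b t < (marginal K θ).real (Set.Ici t) := by
  rw [hK.coneTail_lt_measureReal_marginal_Ici_iff (by linarith) (by linarith)] at hs hu ⊢
  exact (lt_min hs hu).trans_le
    (min_volume_smul_cap_le hK.convex hK.isCompact.measurableSet hst htu hub)

theorem IsConvexBody.ordConnected_setOf_coneTail_lt (hK : IsConvexBody K) (hab : a < b) :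
    {t | coneTail n a b t < (marginal K θ).real (Set.Ici t)}.OrdConnected := by
  have := hK.isProbabilityMeasure_marginal θ
  have hanti : ∀ {s t}, s ≤ t → (marginal K θ).real (Set.Ici t) ≤ (marginal K θ).real (Set.Ici s) :=
    fun h => measureReal_mono (Set.Ici_subset_Ici.2 h)
  refine Set.ordConnected_of_Ioo fun s hs u hu _ t ⟨hst, htu⟩ => ?_
  rw [Set.mem_ofPred_eq] at hs hu ⊢
  have has : a ≤ s := le_of_not_ge fun hsa =>
    (hs.trans_le measureReal_le_one).ne (coneTail_of_le hab hsa)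
  rcases lt_or_ge u b with hub | hbu
  · exact hK.coneTail_lt_measureReal_marginal_Ici_of_lt has hst htu hub hs hu
  rcases lt_or_ge t b with htb | hbt
  · have hnear : ∀ᶠ r in 𝓝[<] b, coneTail n a b r < (marginal K θ).real (Set.Ici u) := by
      refine nhdsWithin_le_nhds
        ((continuous_coneTail n a b).continuousAt.eventually_lt continuousAt_const ?_)
      rwa [coneTail_of_ge hab le_rfl, ← coneTail_of_ge hab hbu]
    obtain ⟨r, hr, htr, hrb⟩ := (hnear.and (Ioo_mem_nhdsLT htb)).exists
    exact hK.coneTail_lt_measureReal_marginal_Ici_of_lt has hst htr hrb hs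
      (hr.trans_le (hanti (hrb.le.trans hbu)))
  · rw [coneTail_of_ge hab hbt, ← coneTail_of_ge hab hbu]
    exact hu.trans_le (hanti htu.le)

end TailComparison

section Hyperplanes

variable {E : Type*} [NormedAddCommGroup E] [InnerProductSpace ℝ E]

theorem exists_inner_lt_of_notMem_affineSubspace {H : AffineSubspace ℝ E}
    [H.direction.HasOrthogonalProjection] (hH : (H : Set E).Nonempty) {v : E} (hv : v ∉ H) :
    ∃ (θ : E) (a : ℝ), (∀ x ∈ H, inner ℝ x θ = a) ∧ a < inner ℝ v θ := by
  have : Nonempty H := hH.to_subtype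
  let y : E := EuclideanGeometry.orthogonalProjection H v
  have hy : y ∈ H := EuclideanGeometry.orthogonalProjection_mem v
  have hvy : v - y ≠ 0 := sub_ne_zero.2 fun h => hv (h ▸ hy)
  refine ⟨v - y, inner ℝ y (v - y), fun x hx => ?_, ?_⟩
  · rw [← sub_eq_zero, ← inner_sub_left]
    exact EuclideanGeometry.vsub_orthogonalProjection_mem_direction_orthogonal H v _
      (AffineSubspace.vsub_mem_direction hx hy)
  · rw [← sub_pos, ← inner_sub_left]
    exact real_inner_self_pos.2 hvy

theorem exists_affineSubspace_forall_mem_iff_inner_eq {θ : E} (hθ : θ ≠ 0) (a : ℝ) :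
    ∃ H : AffineSubspace ℝ E, (H : Set E).Nonempty ∧ H.direction = (Submodule.span ℝ {θ})ᗮ ∧
      ∀ x, x ∈ H ↔ inner ℝ x θ = a := by
  have hθθ : inner ℝ θ θ ≠ (0 : ℝ) := inner_self_ne_zero.2 hθ
  refine ⟨AffineSubspace.mk' ((a / inner ℝ θ θ) • θ) (Submodule.span ℝ {θ})ᗮ,
    AffineSubspace.mk'_nonempty _ _, AffineSubspace.direction_mk' _ _, fun x => ?_⟩
  rw [AffineSubspace.mem_mk', Submodule.mem_orthogonal_singleton_iff_inner_left,
    vsub_eq_sub, inner_sub_left, real_inner_smul_left, div_mul_cancel₀ _ hθθ, sub_eq_zero]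

theorem inner_homothety_apply (v x θ : E) (l : ℝ) :
    inner ℝ (AffineMap.homothety v l x) θ = inner ℝ v θ - l * (inner ℝ v θ - inner ℝ x θ) := by
  rw [AffineMap.homothety_apply, vsub_eq_sub, vadd_eq_add, inner_add_left, real_inner_smul_left,
    inner_sub_left]
  ring

theorem homothety_mem_of_convex {K : Set E} (hK : Convex ℝ K) {v x : E} (hv : v ∈ K) (hx : x ∈ K)
    {l : ℝ} (hl : l ∈ Set.Icc 0 1) : AffineMap.homothety v l x ∈ K := by
  rw [AffineMap.homothety_eq_lineMap]
  exact hK.lineMap_mem hv hx hl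

theorem mem_convexHull_insert_iff_homothety {v x : E} {B : Set E} (hB : B.Nonempty) :
    x ∈ convexHull ℝ (insert v B) ↔
      ∃ y ∈ convexHull ℝ B, ∃ l ∈ Set.Icc (0 : ℝ) 1, AffineMap.homothety v l y = x := by
  simp only [convexHull_insert hB, convexJoin_singleton_left, Set.mem_iUnion, exists_prop,
    segment_eq_image_lineMap, Set.mem_image, AffineMap.homothety_eq_lineMap]

theorem isCompact_convexHull_insert {B : Set E} (hBc : IsCompact B) (hB : Convex ℝ B) (v : E) :
    IsCompact (convexHull ℝ (insert v B)) := by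
  rcases B.eq_empty_or_nonempty with rfl | hB0
  · simp
  have hcont : Continuous fun y : E × ℝ => AffineMap.homothety v y.2 y.1 := by
    simp only [AffineMap.homothety_apply, vsub_eq_sub, vadd_eq_add]
    fun_prop
  convert (hBc.prod (isCompact_Icc (a := (0 : ℝ)) (b := 1))).image hcont
  ext x
  simp only [mem_convexHull_insert_iff_homothety hB0, hB.convexHull_eq, Set.mem_image,
    Prod.exists, Set.mem_prod, and_assoc, exists_and_left]

end Hyperplanes

section Cones

variable {n : ℕ} {a b l : ℝ} {K B : Set (EuclideanSpace ℝ (Fin n))}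
  {v θ : EuclideanSpace ℝ (Fin n)}

/-- In the direction `θ`, the marginal of `K` is that of a cone with base normal to `θ` and apex
above the base. -/
def HasConeTail (K : Set (EuclideanSpace ℝ (Fin n))) (θ : EuclideanSpace ℝ (Fin n)) : Prop :=
  ∃ a b, a < b ∧ ∀ t, (marginal K θ).real (Set.Ici t) = coneTail n a b t

theorem homothety_image_subset_cap (hK : Convex ℝ K) (hv : v ∈ K)
    (hge : ∀ x ∈ K, a ≤ inner ℝ x θ) (hl : l ∈ Set.Icc 0 1) :
    AffineMap.homothety v l '' K ⊆ cap K θ (inner ℝ v θ - l * (inner ℝ v θ - a)) := by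
  rintro _ ⟨x, hx, rfl⟩
  refine ⟨homothety_mem_of_convex hK hv hx hl, ?_⟩
  rw [Set.mem_ofPred_eq, inner_homothety_apply]
  exact sub_le_sub_left (mul_le_mul_of_nonneg_left (sub_le_sub_left (hge x hx) _) hl.1) _

theorem volume_real_image_homothety (v : EuclideanSpace ℝ (Fin n)) (hl : 0 ≤ l)
    (K : Set (EuclideanSpace ℝ (Fin n))) :
    volume.real (AffineMap.homothety v l '' K) = l ^ n * volume.real K := by
  rw [Measure.real, Measure.addHaar_image_homothety, ENNReal.toReal_mul,
    finrank_euclideanSpace_fin, abs_of_nonneg (pow_nonneg hl n),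
    ENNReal.toReal_ofReal (pow_nonneg hl n), Measure.real]

theorem cap_convexHull_insert (hB : B.Nonempty) (hBa : ∀ x ∈ B, inner ℝ x θ = a)
    (hav : a < inner ℝ v θ) (hl : l ∈ Set.Icc 0 1) :
    cap (convexHull ℝ (insert v B)) θ (inner ℝ v θ - l * (inner ℝ v θ - a)) =
      AffineMap.homothety v l '' convexHull ℝ (insert v B) := by
  have hBa' : ∀ x ∈ convexHull ℝ B, inner ℝ x θ = a :=
    convexHull_min hBa (convex_hyperplane ((innerₗ _).flip θ).isLinear a)
  have hge : ∀ x ∈ convexHull ℝ (insert v B), a ≤ inner ℝ x θ :=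
    convexHull_min (Set.insert_subset hav.le fun x hx => (hBa x hx).ge)
      (convex_halfSpace_ge ((innerₗ _).flip θ).isLinear a)
  refine Set.Subset.antisymm ?_ (homothety_image_subset_cap (convex_convexHull ℝ _)
    (subset_convexHull ℝ _ (Set.mem_insert v B)) hge hl)
  rintro _ ⟨hx, hxt⟩
  obtain ⟨y, hy, m, hm, rfl⟩ := (mem_convexHull_insert_iff_homothety hB).1 hx
  rw [Set.mem_ofPred_eq, inner_homothety_apply, hBa' y hy, sub_le_sub_iff_left,
    mul_le_mul_iff_left₀ (sub_pos.2 hav)] at hxt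
  refine ⟨AffineMap.homothety v (m / l) y, (mem_convexHull_insert_iff_homothety hB).2
    ⟨y, hy, m / l, ⟨div_nonneg hm.1 hl.1, div_le_one_of_le₀ hxt hl.1⟩, rfl⟩, ?_⟩
  rw [← AffineMap.homothety_mul_apply, mul_div_cancel_of_imp' fun hl0 => ?_]
  exact le_antisymm (hl0 ▸ hxt) hm.1

theorem IsConvexBody.eq_coneTail_of_forall_mem_Icc (hK : IsConvexBody K) (hn : n ≠ 0) (hab : a < b)
    (h : ∀ t ∈ Set.Icc a b, (marginal K θ).real (Set.Ici t) = coneTail n a b t) (t : ℝ) :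
    (marginal K θ).real (Set.Ici t) = coneTail n a b t := by
  have := hK.isProbabilityMeasure_marginal θ
  have hanti : ∀ {s t}, s ≤ t → (marginal K θ).real (Set.Ici t) ≤ (marginal K θ).real (Set.Ici s) :=
    fun h => measureReal_mono (Set.Ici_subset_Ici.2 h)
  rcases le_total t a with hta | hat
  · rw [coneTail_of_le hab hta]
    refine le_antisymm measureReal_le_one ?_
    rw [← coneTail_of_le hab le_rfl, ← h a ⟨le_rfl, hab.le⟩]
    exact hanti hta
  rcases le_total t b with htb | hbt
  · exact h t ⟨hat, htb⟩
  · rw [coneTail_of_ge hab hbt, zero_pow hn]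
    refine le_antisymm ?_ measureReal_nonneg
    rw [← zero_pow hn, ← coneTail_of_ge hab le_rfl, ← h b ⟨hab.le, le_rfl⟩]
    exact hanti hbt

theorem IsCone.ne_zero (hK : IsCone K) : n ≠ 0 := by
  obtain ⟨-, H, -, -, hH, -⟩ := hK
  exact hH ▸ Nat.succ_ne_zero _

theorem IsConeWithBase.base_nonempty (hB : IsConeWithBase K B) (hK : IsConvexBody K) :
    B.Nonempty := by
  have := NeZero.mk (IsCone.ne_zero ⟨B, hB⟩)
  obtain ⟨H, v, -, -, -, -, rfl⟩ := hB
  by_contra! rfl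
  exact hK.volume_ne_zero (by simp)

theorem IsConeWithBase.exists_hasConeTail (hB : IsConeWithBase K B) (hK : IsConvexBody K) :
    ∃ θ ≠ 0, HasConeTail K θ := by
  have hn := IsCone.ne_zero ⟨B, hB⟩
  have hB0 := hB.base_nonempty hK
  obtain ⟨H, v, hH, -, hBH, hv, rfl⟩ := hB
  obtain ⟨θ, a, hHa, hav⟩ := exists_inner_lt_of_notMem_affineSubspace hH hv
  have hBa : ∀ x ∈ B, inner ℝ x θ = a := fun x hx => hHa x (hBH hx)
  have hθ : θ ≠ 0 := by
    rintro rfl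
    simp [← hBa _ hB0.some_mem] at hav
  refine ⟨θ, hθ, a, inner ℝ v θ, hav,
    hK.eq_coneTail_of_forall_mem_Icc hn hav fun t ht => ?_⟩
  have hd : 0 < inner ℝ v θ - a := sub_pos.2 hav
  have hl : (inner ℝ v θ - t) / (inner ℝ v θ - a) ∈ Set.Icc 0 1 :=
    ⟨div_nonneg (sub_nonneg.2 ht.2) hd.le, (div_le_one hd).2 (sub_le_sub_left ht.1 _)⟩
  have hcap := cap_convexHull_insert hB0 hBa hav hl
  rw [div_mul_cancel₀ _ hd.ne', sub_sub_cancel] at hcap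
  rw [measureReal_marginal_Ici hK.isCompact.measurableSet, hcap,
    volume_real_image_homothety v hl.1, mul_div_cancel_right₀ _ hK.volume_real_pos.ne',
    coneTail_of_mem_Icc hav ht]

section Converse

variable (hK : IsConvexBody K) (hab : a < b)
  (h : ∀ t, (marginal K θ).real (Set.Ici t) = coneTail n a b t)
include hK h

theorem IsConvexBody.volume_real_cap_of_hasConeTail (t : ℝ) :
    volume.real (cap K θ t) = coneTail n a b t * volume.real K := by
  rw [← h, measureReal_marginal_Ici hK.isCompact.measurableSet,
    div_mul_cancel₀ _ hK.volume_real_pos.ne']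

include hab

theorem IsConvexBody.le_inner_of_hasConeTail {x : EuclideanSpace ℝ (Fin n)} (hx : x ∈ K) :
    a ≤ inner ℝ x θ := by
  have hvol : volume.real K ≤ volume.real (cap K θ a) := by
    rw [hK.volume_real_cap_of_hasConeTail h, coneTail_of_le hab le_rfl, one_mul]
  exact (hK.subset_of_volume_le (isCompact_cap hK.isCompact θ a).isClosed Set.inter_subset_left
    ((ENNReal.toReal_le_toReal hK.volume_ne_top
      (isCompact_cap hK.isCompact θ a).measure_lt_top.ne).1 hvol) hx).2

theorem IsConvexBody.volume_cap_eq_zero_of_hasConeTail (hn : n ≠ 0) :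
    volume (cap K θ b) = 0 := by
  rw [← measureReal_eq_zero_iff (isCompact_cap hK.isCompact θ b).measure_lt_top.ne,
    hK.volume_real_cap_of_hasConeTail h, coneTail_of_ge hab le_rfl, zero_pow hn, zero_mul]

theorem IsConvexBody.exists_apex_of_hasConeTail (hn : n ≠ 0) : ∃ v ∈ K, inner ℝ v θ = b := by
  obtain ⟨v, hv, hmax⟩ := hK.isCompact.exists_isMaxOn (f := fun x => inner ℝ x θ)
    (hK.interior_nonempty.mono interior_subset) (by fun_prop)
  refine ⟨v, hv, le_antisymm ?_ ?_⟩
  · by_contra! hbv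
    have hpos := hK.volume_inter_pos (U := {x | b < inner ℝ x θ})
      (isOpen_lt continuous_const (by fun_prop)) ⟨v, hv, hbv⟩
    refine hpos.not_ge ((measure_mono ?_).trans_eq
      (hK.volume_cap_eq_zero_of_hasConeTail hab h hn))
    exact fun x ⟨hxK, (hbx : b < inner ℝ x θ)⟩ => ⟨hxK, hbx.le⟩
  · by_contra! hvb
    obtain ⟨t, ht, htb⟩ := exists_between (max_lt hab hvb)
    obtain ⟨hat, hvt⟩ := max_lt_iff.1 ht
    have hempty : cap K θ t = ∅ :=
      Set.eq_empty_of_forall_notMem fun x hx => ((hmax hx.1).trans_lt hvt).not_ge hx.2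
    have htail := hK.volume_real_cap_of_hasConeTail h t
    rw [hempty, measureReal_empty, coneTail_of_mem_Icc hab ⟨hat.le, htb.le⟩] at htail
    have hpos : 0 < (b - t) / (b - a) := div_pos (sub_pos.2 htb) (sub_pos.2 hab)
    exact (mul_pos (pow_pos hpos n) hK.volume_real_pos).ne htail

theorem IsConvexBody.cap_eq_image_homothety_of_hasConeTail (hv : v ∈ K) (hvb : inner ℝ v θ = b)
    (hl : l ∈ Set.Ioc 0 1) :
    cap K θ (b - l * (b - a)) = AffineMap.homothety v l '' K := by
  have hba : 0 < b - a := sub_pos.2 hab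
  have hsub : AffineMap.homothety v l '' K ⊆ cap K θ (b - l * (b - a)) := hvb ▸
    homothety_image_subset_cap hK.convex hv (fun x hx => hK.le_inner_of_hasConeTail hab h hx)
      (Set.Ioc_subset_Icc_self hl)
  have hcompact : IsCompact (AffineMap.homothety v l '' K) :=
    hK.isCompact.image (AffineMap.homothety_continuous v l)
  have hcap : IsConvexBody (cap K θ (b - l * (b - a))) := by
    refine ⟨hK.convex.inter (convex_halfSpace_ge ((innerₗ _).flip θ).isLinear _),
      isCompact_cap hK.isCompact θ _, ?_⟩
    exact (hK.interior_nonempty.image _).mono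
      (((AffineMap.homothety_isOpenMap v l hl.1.ne').image_interior_subset K).trans
        (interior_mono hsub))
  refine (hcap.subset_of_volume_le hcompact.isClosed hsub ?_).antisymm hsub
  rw [← ENNReal.toReal_le_toReal hcap.volume_ne_top hcompact.measure_lt_top.ne]
  change volume.real _ ≤ volume.real _
  have ht : b - l * (b - a) ∈ Set.Icc a b :=
    ⟨by linarith [mul_le_of_le_one_left hba.le hl.2], by linarith [mul_pos hl.1 hba]⟩
  rw [hK.volume_real_cap_of_hasConeTail h, coneTail_of_mem_Icc hab ht, sub_sub_cancel,
    mul_div_cancel_right₀ _ hba.ne', volume_real_image_homothety v hl.1.le]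

theorem IsConvexBody.mem_convexHull_of_hasConeTail (hv : v ∈ K) (hvb : inner ℝ v θ = b)
    {x : EuclideanSpace ℝ (Fin n)} (hx : x ∈ K) (hxb : inner ℝ x θ < b) :
    x ∈ convexHull ℝ (insert v (K ∩ {y | inner ℝ y θ = a})) := by
  have hba : 0 < b - a := sub_pos.2 hab
  have hl : (b - inner ℝ x θ) / (b - a) ∈ Set.Ioc 0 1 := ⟨div_pos (sub_pos.2 hxb) hba,
    (div_le_one hba).2 (sub_le_sub_left (hK.le_inner_of_hasConeTail hab h hx) b)⟩
  have hcap := hK.cap_eq_image_homothety_of_hasConeTail hab h hv hvb hl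
  rw [div_mul_cancel₀ _ hba.ne', sub_sub_cancel] at hcap
  have hxcap : x ∈ cap K θ (inner ℝ x θ) := ⟨hx, le_refl (inner ℝ x θ)⟩
  obtain ⟨y, hy, hyx⟩ := hcap ▸ hxcap
  have hya : inner ℝ y θ = a := by
    have hheight := congrArg (fun z => inner ℝ z θ) hyx
    simp only [inner_homothety_apply, hvb] at hheight
    have hmul : (b - inner ℝ x θ) / (b - a) * (b - inner ℝ y θ) = b - inner ℝ x θ := by linarith
    rw [div_mul_eq_mul_div, div_eq_iff hba.ne', mul_right_inj' (sub_pos.2 hxb).ne'] at hmul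
    linarith
  have hyB : y ∈ K ∩ {y | inner ℝ y θ = a} := ⟨hy, hya⟩
  rw [← hyx]
  exact homothety_mem_of_convex (convex_convexHull ℝ _)
    (subset_convexHull ℝ _ (Set.mem_insert _ _))
    (subset_convexHull ℝ _ (Set.mem_insert_of_mem _ hyB)) (Set.Ioc_subset_Icc_self hl)

theorem IsConvexBody.eq_convexHull_of_hasConeTail (hn : n ≠ 0) (hv : v ∈ K)
    (hvb : inner ℝ v θ = b) :
    K = convexHull ℝ (insert v (K ∩ {y | inner ℝ y θ = a})) := by
  refine Set.Subset.antisymm ?_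
    (convexHull_min (Set.insert_subset hv Set.inter_subset_left) hK.convex)
  have hcompact : IsCompact (convexHull ℝ (insert v (K ∩ {y | inner ℝ y θ = a}))) :=
    isCompact_convexHull_insert (hK.isCompact.inter_right (isClosed_eq (by fun_prop) (by fun_prop)))
      (hK.convex.inter (convex_hyperplane ((innerₗ _).flip θ).isLinear a)) v
  by_contra hKL
  refine (hK.volume_inter_pos hcompact.isClosed.isOpen_compl
    (Set.inter_compl_nonempty_iff.2 hKL)).not_ge ((measure_mono ?_).trans_eq
      (hK.volume_cap_eq_zero_of_hasConeTail hab h hn))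
  exact fun x hx => ⟨hx.1, not_lt.1 fun hxb =>
    hx.2 (hK.mem_convexHull_of_hasConeTail hab h hv hvb hx.1 hxb)⟩

end Converse

theorem isNormalTo_of_forall_inner_eq (hB : ∀ x ∈ B, inner ℝ x θ = a) : IsNormalTo θ B := by
  have hspan : vectorSpan ℝ B ≤ (Submodule.span ℝ {θ})ᗮ := by
    rw [vectorSpan_def, Submodule.span_le]
    rintro _ ⟨x, hx, y, hy, rfl⟩
    refine Submodule.mem_orthogonal_singleton_iff_inner_left.2 ?_
    change inner ℝ (x - y) θ = 0
    rw [inner_sub_left, hB x hx, hB y hy, sub_self]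
  exact Submodule.orthogonal_le hspan
    (Submodule.le_orthogonal_orthogonal _ (Submodule.mem_span_singleton_self θ))

theorem HasConeTail.exists_isConeWithBase (h : HasConeTail K θ) (hK : IsConvexBody K)
    (hθ : θ ≠ 0) : ∃ B, IsConeWithBase K B ∧ IsNormalTo θ B := by
  have hn : n ≠ 0 := by
    rintro rfl
    exact hθ (Subsingleton.elim _ _)
  obtain ⟨a, b, hab, h⟩ := h
  obtain ⟨v, hv, hvb⟩ := hK.exists_apex_of_hasConeTail hab h hn
  obtain ⟨H, hne, hdir, hmem⟩ := exists_affineSubspace_forall_mem_iff_inner_eq hθ a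
  refine ⟨K ∩ {x | inner ℝ x θ = a}, ⟨H, v, hne, ?_, fun x hx => (hmem x).2 hx.2, ?_,
    hK.eq_convexHull_of_hasConeTail hab h hn hv hvb⟩,
    isNormalTo_of_forall_inner_eq fun x hx => hx.2⟩
  · have hrank := (Submodule.span ℝ {θ}).finrank_add_finrank_orthogonal
    rw [finrank_span_singleton hθ, finrank_euclideanSpace_fin] at hrank
    rw [hdir, add_comm, hrank]
  · rw [hmem, hvb]
    exact hab.ne'

theorem IsSimplex.isConvexBody {D : Set (EuclideanSpace ℝ (Fin n))} (hD : IsSimplex D) :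
    IsConvexBody D := by
  obtain ⟨S, rfl⟩ := hD
  refine ⟨convex_convexHull _ _, (Set.finite_range _).isCompact_convexHull ℝ, ?_⟩
  rw [interior_convexHull_nonempty_iff_affineSpan_eq_top,
    S.independent.affineSpan_eq_top_iff_card_eq_finrank_add_one]
  simp

theorem IsSimplex.isCone (hn : n ≠ 0) {D : Set (EuclideanSpace ℝ (Fin n))} (hD : IsSimplex D) :
    IsCone D := by
  obtain ⟨S, rfl⟩ := hD
  obtain ⟨m, rfl⟩ := Nat.exists_eq_succ_of_ne_zero hn
  have hface : S.points '' (Set.univ \ {0}) = Set.range fun i : Fin (m + 1) => S.points i.succ := by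
    rw [Set.range_comp' S.points, Fin.range_succ, Set.compl_eq_univ_sdiff]
  refine ⟨Set.range fun i : Fin (m + 1) => S.points i.succ,
    affineSpan ℝ (Set.range fun i : Fin (m + 1) => S.points i.succ), S.points 0,
    (affineSpan_nonempty ℝ).2 (Set.range_nonempty _), ?_, subset_affineSpan _ _, ?_, ?_⟩
  · rw [direction_affineSpan, AffineIndependent.finrank_vectorSpan (n := m) _ (by simp)]
    exact S.independent.comp_embedding (Fin.succEmb _)
  · rw [← hface]
    exact S.independent.notMem_affineSpan_sdiff 0 Set.univ
  · rw [Fin.range_fin_succ]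
    rfl

end Cones

section Ratio

variable {n : ℕ} {p q : ℝ} {K C B : Set (EuclideanSpace ℝ (Fin n))}
  {θ φ : EuclideanSpace ℝ (Fin n)}

theorem signedMoment_smul (q : ℝ) (K : Set (EuclideanSpace ℝ (Fin n)))
    (θ : EuclideanSpace ℝ (Fin n)) (c : ℝ) :
    signedMoment q K (c • θ) = signedRpow q c * signedMoment q K θ := by
  change ∫ x, signedRpow q (inner ℝ x (c • θ)) ∂unif K =
    signedRpow q c * ∫ x, signedRpow q (inner ℝ x θ) ∂unif K
  simp_rw [real_inner_smul_right, signedRpow_mul, integral_const_mul]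

theorem marginalNorm_smul (hp : 0 < p) (K : Set (EuclideanSpace ℝ (Fin n)))
    (θ : EuclideanSpace ℝ (Fin n)) (c : ℝ) :
    marginalNorm p K (c • θ) = |c| * marginalNorm p K θ := by
  have hint : 0 ≤ ∫ x, |inner ℝ x θ| ^ p ∂unif K :=
    integral_nonneg fun x => Real.rpow_nonneg (abs_nonneg _) p
  simp_rw [marginalNorm, real_inner_smul_right, abs_mul,
    Real.mul_rpow (abs_nonneg _) (abs_nonneg _), integral_const_mul]
  rw [Real.mul_rpow (by positivity) hint, one_div, Real.rpow_rpow_inv (abs_nonneg c) hp.ne']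

theorem asymRatio_smul (hp : 0 < p) (hq : 0 < q) (K : Set (EuclideanSpace ℝ (Fin n)))
    (θ : EuclideanSpace ℝ (Fin n)) {c : ℝ} (hc : c ≠ 0) :
    asymRatio p q K (c • θ) = asymRatio p q K θ := by
  rw [asymRatio, asymRatio, signedMoment_smul, marginalNorm_smul hp, abs_mul, abs_signedRpow hq,
    Real.mul_rpow (by positivity) (abs_nonneg _), one_div, Real.rpow_rpow_inv (abs_nonneg c) hq.ne',
    mul_div_mul_left _ _ (abs_ne_zero.2 hc)]

namespace IsConvexBody

theorem exists_inner_ne_zero (hK : IsConvexBody K) (hθ : θ ≠ 0) :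
    ∃ x ∈ K, inner ℝ x θ ≠ 0 := by
  by_contra! h
  have hKθ : K ⊆ (Submodule.span ℝ {θ})ᗮ := fun x hx =>
    Submodule.mem_orthogonal_singleton_iff_inner_left.2 (h x hx)
  refine hK.volume_ne_zero (measure_mono_null hKθ (Measure.addHaar_submodule _ _ fun htop => hθ ?_))
  rw [Submodule.orthogonal_eq_top_iff, Submodule.span_singleton_eq_bot] at htop
  exact htop

theorem marginalNorm_pos (hK : IsConvexBody K) (hp : 0 < p) (hθ : θ ≠ 0) :
    0 < marginalNorm p K θ := by
  refine Real.rpow_pos_of_pos ?_ _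
  have hcont : Continuous fun x : EuclideanSpace ℝ (Fin n) => |inner ℝ x θ| ^ p :=
    (continuous_abs_rpow hp).comp (by fun_prop)
  rw [integral_pos_iff_support_of_nonneg (fun x => by positivity) (hK.integrable_unif hcont), unif,
    ProbabilityTheory.cond_apply hK.isCompact.measurableSet]
  obtain ⟨x, hx, hxθ⟩ := hK.exists_inner_ne_zero hθ
  refine ENNReal.mul_pos (ENNReal.inv_ne_zero.2 hK.volume_ne_top)
    (hK.volume_inter_pos hcont.isOpen_support ⟨x, hx, ?_⟩).ne'
  exact (Real.rpow_pos_of_pos (abs_pos.2 hxθ) p).ne'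

theorem continuous_integral_inner (hK : IsConvexBody K) {f : ℝ → ℝ} (hf : Continuous f) :
    Continuous fun θ : EuclideanSpace ℝ (Fin n) => ∫ x, f (inner ℝ x θ) ∂unif K := by
  simp only [unif, ProbabilityTheory.cond, integral_smul_measure]
  have hcont : Continuous fun θ : EuclideanSpace ℝ (Fin n) => ∫ x in K, f (inner ℝ x θ) :=
    continuous_parametric_integral_of_continuous
      (f := fun θ x : EuclideanSpace ℝ (Fin n) => f (inner ℝ x θ))
      (hf.comp (continuous_snd.inner continuous_fst)) hK.isCompact
  exact continuous_const.mul hcont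

theorem continuousOn_asymRatio (hK : IsConvexBody K) (hp : 0 < p) (hq : 0 < q) :
    ContinuousOn (asymRatio p q K) (Metric.sphere 0 1) := by
  have hnum : Continuous (signedMoment q K) :=
    hK.continuous_integral_inner (continuous_signedRpow hq)
  have hden : Continuous (marginalNorm p K) :=
    (hK.continuous_integral_inner (continuous_abs_rpow hp)).rpow_const
      fun _ => Or.inr (one_div_pos.2 hp).le
  exact (hnum.abs.rpow_const fun _ => Or.inr (one_div_pos.2 hq).le).continuousOn.div
    hden.continuousOn fun θ hθ => (hK.marginalNorm_pos hp (ne_zero_of_mem_unit_sphere ⟨θ, hθ⟩)).ne'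

theorem isGreatest_alphaStar (hK : IsConvexBody K) (hn : n ≠ 0) (hp : 0 < p) (hq : 0 < q) :
    IsGreatest (asymRatio p q K '' Metric.sphere 0 1) (alphaStar p q K) := by
  have := NeZero.mk hn
  exact ((isCompact_sphere _ _).image_of_continuousOn
    (hK.continuousOn_asymRatio hp hq)).isGreatest_sSup
    ((NormedSpace.sphere_nonempty.2 zero_le_one).image _)

theorem asymRatio_le_alphaStar (hK : IsConvexBody K) (hp : 0 < p) (hq : 0 < q) (hθ : θ ≠ 0) :
    asymRatio p q K θ ≤ alphaStar p q K := by
  have hn : n ≠ 0 := by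
    rintro rfl
    exact hθ (Subsingleton.elim _ _)
  rw [← asymRatio_smul hp hq K θ (inv_ne_zero (norm_ne_zero_iff.2 hθ))]
  refine (hK.isGreatest_alphaStar hn hp hq).2 (Set.mem_image_of_mem _ ?_)
  rw [mem_sphere_zero_iff_norm, norm_smul, norm_inv, norm_norm,
    inv_mul_cancel₀ (norm_ne_zero_iff.2 hθ)]

theorem exists_marginalNorm_smul_eq (hK : IsConvexBody K) (hp : 0 < p) (hq : 0 < q) (hθ : θ ≠ 0)
    {r : ℝ} (hr : 0 < r) :
    ∃ c : ℝ, c ≠ 0 ∧ marginalNorm p K (c • θ) = r ∧ 0 ≤ signedMoment q K (c • θ) := by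
  have hN := hK.marginalNorm_pos hp hθ
  have hc : 0 < r / marginalNorm p K θ := div_pos hr hN
  have hcq : 0 ≤ signedRpow q (r / marginalNorm p K θ) := by
    rw [signedRpow_of_nonneg hq hc.le]
    exact Real.rpow_nonneg hc.le q
  rcases le_total 0 (signedMoment q K θ) with hs | hs
  · refine ⟨r / marginalNorm p K θ, hc.ne', ?_, ?_⟩
    · rw [marginalNorm_smul hp, abs_of_pos hc, div_mul_cancel₀ _ hN.ne']
    · rw [signedMoment_smul]
      exact mul_nonneg hcq hs
  · refine ⟨-(r / marginalNorm p K θ), neg_ne_zero.2 hc.ne', ?_, ?_⟩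
    · rw [marginalNorm_smul hp, abs_neg, abs_of_pos hc, div_mul_cancel₀ _ hN.ne']
    · rw [signedMoment_smul, signedRpow_neg]
      exact mul_nonneg_of_nonpos_of_nonpos (neg_nonpos.2 hcq) hs

theorem signedMoment_le_of_hasConeTail (hK : IsConvexBody K) (hK0 : IsCentered K)
    (hC : IsConvexBody C) (hC0 : IsCentered C) (hCφ : HasConeTail C φ) (hp : 1 < p) (hpq : p < q)
    (hnorm : marginalNorm p K θ = marginalNorm p C φ) :
    signedMoment q K θ ≤ signedMoment q C φ ∧
      (signedMoment q K θ = signedMoment q C φ → HasConeTail K θ) := by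
  have := hK.isProbabilityMeasure_marginal θ
  have := hC.isProbabilityMeasure_marginal φ
  obtain ⟨a, b, hab, htail⟩ := hCφ
  obtain ⟨M, hMK, hMC⟩ := ((eventually_ae_marginal_mem_Icc hK.isCompact θ).and
    (eventually_ae_marginal_mem_Icc hC.isCompact φ)).exists
  have hmean : ∫ t, t ∂marginal K θ = ∫ t, t ∂marginal C φ := by
    rw [hK.integral_id_marginal hK0, hC.integral_id_marginal hC0]
  have hpth : ∫ t, |t| ^ p ∂marginal K θ = ∫ t, |t| ^ p ∂marginal C φ := by
    have hp0 : 0 < p := by linarith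
    rw [integral_marginal (continuous_abs_rpow hp0), integral_marginal (continuous_abs_rpow hp0)]
    exact (Real.rpow_left_inj (integral_nonneg fun x => by positivity)
      (integral_nonneg fun x => by positivity) (one_div_pos.2 hp0).ne').1 hnorm
  obtain ⟨hle, heq⟩ := integral_signedRpow_le_of_ordConnected hp hpq hMK hMC hmean hpth
    (by simpa only [htail] using hK.ordConnected_setOf_coneTail_lt hab)
  have hq : 0 < q := by linarith
  rw [integral_marginal (continuous_signedRpow hq),
    integral_marginal (continuous_signedRpow hq)] at hle heq
  exact ⟨hle, fun h => ⟨a, b, hab, fun t => heq h ▸ htail t⟩⟩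

theorem asymRatio_le_of_hasConeTail (hK : IsConvexBody K) (hK0 : IsCentered K)
    (hC : IsConvexBody C) (hC0 : IsCentered C) (hCφ : HasConeTail C φ) (hp : 1 < p) (hpq : p < q)
    (hθ : θ ≠ 0) (hφ : φ ≠ 0) :
    asymRatio p q K θ ≤ asymRatio p q C φ ∧
      (asymRatio p q K θ = asymRatio p q C φ → ∃ B, IsConeWithBase K B ∧ IsNormalTo θ B) := by
  have hp0 : 0 < p := by linarith
  have hq0 : 0 < q := by linarith
  have hN := hC.marginalNorm_pos hp0 hφ
  obtain ⟨c, hc, hnorm, hs⟩ := hK.exists_marginalNorm_smul_eq hp0 hq0 hθ hN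
  obtain ⟨hle, heq⟩ := hK.signedMoment_le_of_hasConeTail hK0 hC hC0 hCφ hp hpq hnorm
  rw [← asymRatio_smul hp0 hq0 K θ hc, asymRatio, asymRatio, hnorm, abs_of_nonneg hs,
    abs_of_nonneg (hs.trans hle)]
  refine ⟨by gcongr, fun h => ?_⟩
  rw [div_left_inj' hN.ne', Real.rpow_left_inj hs (hs.trans hle) (one_div_pos.2 hq0).ne'] at h
  obtain ⟨B, hB, hBn⟩ := (heq h).exists_isConeWithBase hK (smul_ne_zero hc hθ)
  exact ⟨B, hB, (Submodule.smul_mem_iff _ hc).1 hBn⟩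

theorem asymRatio_le_alphaStar_of_isCone (hK : IsConvexBody K) (hK0 : IsCentered K)
    (hC : IsConvexBody C) (hC0 : IsCentered C) (hCcone : IsCone C) (hp : 1 < p) (hpq : p < q)
    (hθ : θ ≠ 0) :
    asymRatio p q K θ ≤ alphaStar p q C ∧
      (asymRatio p q K θ = alphaStar p q C → ∃ B, IsConeWithBase K B ∧ IsNormalTo θ B) := by
  obtain ⟨B, hB⟩ := hCcone
  obtain ⟨φ, hφ, hCφ⟩ := hB.exists_hasConeTail hC
  have hφC : asymRatio p q C φ ≤ alphaStar p q C :=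
    hC.asymRatio_le_alphaStar (by linarith) (by linarith) hφ
  obtain ⟨hle, heq⟩ := hK.asymRatio_le_of_hasConeTail hK0 hC hC0 hCφ hp hpq hθ hφ
  exact ⟨hle.trans hφC, fun h => heq (hle.antisymm (hφC.trans_eq h.symm))⟩

theorem alphaStar_le_of_isCone (hK : IsConvexBody K) (hK0 : IsCentered K)
    (hC : IsConvexBody C) (hC0 : IsCentered C) (hCcone : IsCone C) (hp : 1 < p) (hpq : p < q) :
    alphaStar p q K ≤ alphaStar p q C := by
  obtain ⟨θ, hθ, hmax⟩ :=
    (hK.isGreatest_alphaStar (p := p) (q := q) hCcone.ne_zero (by linarith) (by linarith)).1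
  rw [← hmax]
  exact (hK.asymRatio_le_alphaStar_of_isCone hK0 hC hC0 hCcone hp hpq
    (ne_zero_of_mem_unit_sphere ⟨θ, hθ⟩)).1

end IsConvexBody

end Ratio

theorem theorem10_general {n : ℕ} {p q : ℝ} (hp : 1 < p) (hpq : p < q)
    {C : Set (EuclideanSpace ℝ (Fin n))} (hC : IsConvexBody C) (hC0 : IsCentered C)
    (hCcone : IsCone C) {K : Set (EuclideanSpace ℝ (Fin n))} (hK : IsConvexBody K)
    (hK0 : IsCentered K) :
    IsGreatest (asymRatio p q K '' Metric.sphere 0 1) (alphaStar p q K) ∧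
    alphaStar p q K ≤ alphaStar p q C ∧
    (alphaStar p q K = alphaStar p q C ↔ IsCone K) ∧
    (IsCone K → ∀ θ ∈ Metric.sphere (0 : EuclideanSpace ℝ (Fin n)) 1,
      asymRatio p q K θ = alphaStar p q K → ∃ B, IsConeWithBase K B ∧ IsNormalTo θ B) := by
  have hmax := hK.isGreatest_alphaStar (p := p) (q := q) hCcone.ne_zero
    (by linarith) (by linarith)
  have hle := hK.alphaStar_le_of_isCone hK0 hC hC0 hCcone hp hpq
  refine ⟨hmax, hle, ⟨fun h => ?_, fun hKcone =>
    hle.antisymm (hC.alphaStar_le_of_isCone hC0 hK hK0 hKcone hp hpq)⟩, fun hKcone θ hθ =>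
    (hK.asymRatio_le_alphaStar_of_isCone hK0 hK hK0 hKcone hp hpq
      (ne_zero_of_mem_unit_sphere ⟨θ, hθ⟩)).2⟩
  obtain ⟨θ, hθ, hθmax⟩ := hmax.1
  obtain ⟨B, hB, -⟩ := (hK.asymRatio_le_alphaStar_of_isCone hK0 hC hC0 hCcone hp hpq
    (ne_zero_of_mem_unit_sphere ⟨θ, hθ⟩)).2 (hθmax.trans h)
  exact ⟨B, hB⟩

theorem theorem10 {n : ℕ} (hn : 1 ≤ n) {p q : ℝ} (hp : 1 < p) (hpq : p < q)
    (D : Set (EuclideanSpace ℝ (Fin n))) (hD : IsSimplex D) (hD0 : IsCentered D)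
    (K : Set (EuclideanSpace ℝ (Fin n))) (hK : IsConvexBody K) (hK0 : IsCentered K) :
    IsGreatest (asymRatio p q K '' Metric.sphere 0 1) (alphaStar p q K) ∧
    alphaStar p q K ≤ alphaStar p q D ∧
    (alphaStar p q K = alphaStar p q D ↔ IsCone K) ∧
    (IsCone K → ∀ θ ∈ Metric.sphere (0 : EuclideanSpace ℝ (Fin n)) 1,
      asymRatio p q K θ = alphaStar p q K → ∃ B, IsConeWithBase K B ∧ IsNormalTo θ B) :=
  theorem10_general hp hpq hD.isConvexBody hD0 (hD.isCone (Nat.one_le_iff_ne_zero.1 hn)) hK hK0
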